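/- Let $M$ be a compact $C^\infty$ manifold without boundary with a $C^\infty$ Riemannian metric, let $\mathrm{dist}$ be the Riemannian distance (equal to $+\infty$ between different components if $M$ is not connected), and let $f:M\to M$ be a $C^2$ diffeomorphism. For a set $I$ of consecutive integers and $d>0$, a sequence $\{y_k\}_{k\in I}$ in $M$ is a $d$-pseudotrajectory if $\mathrm{dist}(y_{k+1},f(y_k))<d$ whenever $k,k+1\in I$, and an exact trajectory if $y_{k+1}=f(y_k)$ whenever $k,k+1\in I$. For $\theta\in(0,1)$ and $\omega\ge 0$, the map $f$ satisfies $\mathrm{FinHolSh}(\theta,\omega)$ if there are constants $d_0,L,C>0$ such that for every $d\in(0,d_0)$ and every $d$-pseudotrajectory $\{y_k\}_{k\in[0,Cd^{-\omega}]}$ there is an exact trajectory $\{x_k\}_{k\in[0,Cd^{-\omega}]}$ with $\mathrm{dist}(x_k,y_k)<Ld^{\theta}$ for all integers $k\in[0,Cd^{-\omega}]$. Let $E_k$, $k\in\mathbb Z$, be finite-dimensional Euclidean spaces and $\mathcal A=\{A_k:E_k\to E_{k+1}\}_{k\in\mathbb Z}$ linear isomorphisms such that, for some $R>0$, $\|A_k\|<R$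 and $\|A_k^{-1}\|<R$ for all $k$. The sequence $\mathcal A$ has the slow growth property $\mathrm{SG}(\gamma)$ if there is $L>0$ such that for all $i\in\mathbb Z$, all integers $N>0$ and all $\{w_k\in E_k\}_{k\in[i+1,i+N]}$ with $|w_k|\le 1$ there is a sequence $\{v_k\in E_k\}_{k\in[i,i+N]}$ with $v_{k+1}=A_kv_k+w_{k+1}$ for $k\in[i,i+N-1]$ and $|v_k|\le LN^{\gamma}$ for $k\in[i,i+N]$. Lemma. Let $\theta\in(0,1)$ and $\omega\ge0$ satisfy $\theta>1/2$ and $\theta+\omega>1$, and suppose that $f$ satisfies $\mathrm{FinHolSh}(\theta,\omega)$. Then there is $\gamma\in(0,1)$ such that for every exact trajectory $\{p_k\}_{k\in\mathbb Z}$ of $f$ the sequence $A_k=Df(p_k):T_{p_k}M\to T_{p_{k+1}}M$ of linear isomorphisms is uniformly bounded together with its inverses (as above) and satisfies $\mathrm{SG}(\gamma)$. -/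

import Mathlib

open Set Bundle
open scoped Manifold ContDiff

noncomputable section

namespace FinHolder

/-- `y` is a `d`-pseudotrajectory of `f` on the set of times `I`. A sequence on `I` is given by a
sequence on all of `ℤ` whose values outside `I` play no role. -/
def IsPseudotrajectory {M : Type*} [EMetricSpace M] (f : M → M) (d : ℝ) (I : Set ℤ)
    (y : ℤ → M) : Prop :=
  ∀ k : ℤ, k ∈ I → k + 1 ∈ I → edist (y (k + 1)) (f (y k)) < ENNReal.ofReal d

/-- `x` is an exact trajectory of `f` on the set of times `I`. -/
def IsTrajectory {M : Type*} (f : M → M) (I : Set ℤ) (x : ℤ → M) : Prop :=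
  ∀ k : ℤ, k ∈ I → k + 1 ∈ I → x (k + 1) = f (x k)

/-- The integers of the interval `[0, T]`. -/
def timeWindow (T : ℝ) : Set ℤ := {k : ℤ | 0 ≤ k ∧ (k : ℝ) ≤ T}

/-- The finite Hölder shadowing property with exponents `θ` and `η` (used for `θ ∈ (0, 1)` and
`η ≥ 0`). -/
def FinHolSh {M : Type*} [EMetricSpace M] (f : M → M) (θ η : ℝ) : Prop :=
  ∃ d₀ > (0 : ℝ), ∃ L > (0 : ℝ), ∃ C > (0 : ℝ), ∀ d : ℝ, 0 < d → d < d₀ →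
    ∀ y : ℤ → M, IsPseudotrajectory f d (timeWindow (C * d ^ (-η))) y →
      ∃ x : ℤ → M, IsTrajectory f (timeWindow (C * d ^ (-η))) x ∧
        ∀ k ∈ timeWindow (C * d ^ (-η)), edist (x k) (y k) < ENNReal.ofReal (L * d ^ θ)

section Cocycle

variable {E : ℤ → Type*} [∀ k, NormedAddCommGroup (E k)] [∀ k, InnerProductSpace ℝ (E k)]

/-- The isomorphisms `A k : E k → E (k + 1)` and their inverses are uniformly bounded. -/
def UniformlyBounded (A : ∀ k : ℤ, E k ≃L[ℝ] E (k + 1)) : Prop :=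
  ∃ R > (0 : ℝ), ∀ k : ℤ,
    ‖(A k : E k →L[ℝ] E (k + 1))‖ < R ∧ ‖((A k).symm : E (k + 1) →L[ℝ] E k)‖ < R

/-- The slow growth property with exponent `γ`: the inhomogeneous linear equation
`v (k + 1) = A k (v k) + w (k + 1)` on a window of length `N`, with right-hand side bounded by `1`,
has a solution of size at most `L * N ^ γ`, with `L` depending neither on the position nor on the
length of the window. -/
def SlowGrowth (A : ∀ k : ℤ, E k ≃L[ℝ] E (k + 1)) (γ : ℝ) : Prop :=
  ∃ L > (0 : ℝ), ∀ (i : ℤ) (N : ℕ), 0 < N → ∀ w : ∀ k : ℤ, E k,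
    (∀ k ∈ Icc (i + 1) (i + N), ‖w k‖ ≤ 1) →
      ∃ v : ∀ k : ℤ, E k,
        (∀ k ∈ Icc i (i + N - 1), v (k + 1) = A k (v k) + w (k + 1)) ∧
        ∀ k ∈ Icc i (i + N), ‖v k‖ ≤ L * (N : ℝ) ^ γ

end Cocycle

section Derivative

variable {m : ℕ} {M : Type*} [TopologicalSpace M] [ChartedSpace (EuclideanSpace ℝ (Fin m)) M]

/-- The identification of the tangent spaces at two equal points. -/
def tangentCongr (m : ℕ) {M : Type*} [TopologicalSpace M]
    [ChartedSpace (EuclideanSpace ℝ (Fin m)) M] {x y : M} (h : x = y) :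
    TangentSpace (𝓡 m) x ≃L[ℝ] TangentSpace (𝓡 m) y :=
  h ▸ ContinuousLinearEquiv.refl ℝ (TangentSpace (𝓡 m) x)

/-- The derivative cocycle `D f (p k) : T_{p k} M → T_{p (k + 1)} M` along a trajectory `p` of a
`C^2` diffeomorphism `f`. -/
def derivCocycle [IsManifold (𝓡 m) ∞ M] (f : M ≃ₘ^2⟮𝓡 m, 𝓡 m⟯ M) (p : ℤ → M)
    (hp : IsTrajectory f univ p) (k : ℤ) :
    TangentSpace (𝓡 m) (p k) ≃L[ℝ] TangentSpace (𝓡 m) (p (k + 1)) :=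
  (f.mfderivToContinuousLinearEquiv two_ne_zero (p k)).trans
    (tangentCongr m (hp k (mem_univ _) (mem_univ _)).symm)

end Derivative

end FinHolder

end

open Filter Topology

noncomputable section

namespace FinHolder

/-! The proof is a bootstrap on the best bound for the linear equation. Suppose every right-hand
side `w` with `|w| ≤ 1` on a window of length `N` has a solution with `|v| ≤ Q`. In coordinates
around `p k`, the points `s • v k` form a pseudotrajectory with error of order `s`, provided `s Q²`
is small. If `N` fits in the shadowing window, an exact trajectory lies within order `s^θ` of it.
Its coordinates `c k` solve the homogeneous linear equation up to an error quadratic in `e = s Q +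
O(s^θ)`. Removing this error by a solution `z` of the linear equation, of size `O(e² Q)`, makes `c -
z` homogeneous, so `v - (c - z) / s` solves the equation for the same `w`, with bound `O(s^(θ-1) +
e² Q / s)`.

For suitable `s` this is at most `3/4 * Q` whenever `Q ≥ B N^γ`, `γ = (1 - θ) / η`. The terms
`s^(2θ-1)` and the requirement `s ≲ Q⁻²` need `θ > 1/2`; the window length dictates `γ`, and `γ < 1`
means `θ + η > 1`. Iterating from any finite bound ends below `B N^γ`. The step is
`SolvableWithBound.improve`, the iteration `FinHolSh.exists_slowGrowth_bound`, and
`exists_uniform_charts` supplies coordinates with uniform constants by compactness. -/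

/-- `φ` is a parametrization of a neighbourhood of `p` by a ball of a normed space, with inverse
`ψ`; both are Lipschitz with constant `K`, at scale `K⁻¹`. -/
structure IsLipschitzParam {M E : Type*} [EMetricSpace M] [NormedAddCommGroup E]
    (K : ℝ) (p : M) (φ : E → M) (ψ : M → E) : Prop where
  zero : φ 0 = p
  lip : ∀ u v, K * ‖u‖ ≤ 1 → K * ‖v‖ ≤ 1 → edist (φ u) (φ v) ≤ ENNReal.ofReal (K * ‖u - v‖)
  inv_lip : ∀ x y δ, edist x p < ENNReal.ofReal K⁻¹ → edist y p < ENNReal.ofReal K⁻¹ → 0 ≤ δ →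
    edist x y ≤ ENNReal.ofReal δ → ‖ψ x - ψ y‖ ≤ K * δ
  right_inv : ∀ x, edist x p < ENNReal.ofReal K⁻¹ → φ (ψ x) = x
  left_inv : ∀ u, K * ‖u‖ ≤ 1 → ψ (φ u) = u

theorem IsLipschitzParam.mono {M E : Type*} [EMetricSpace M] [NormedAddCommGroup E]
    {K K' : ℝ} {p : M} {φ : E → M} {ψ : M → E} (h : IsLipschitzParam K p φ ψ) (hK : 0 < K)
    (hKK' : K ≤ K') : IsLipschitzParam K' p φ ψ := by
  have h1 : ∀ u : E, K' * ‖u‖ ≤ 1 → K * ‖u‖ ≤ 1 := fun u hu =>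
    (mul_le_mul_of_nonneg_right hKK' (norm_nonneg u)).trans hu
  have h2 : ENNReal.ofReal K'⁻¹ ≤ ENNReal.ofReal K⁻¹ :=
    ENNReal.ofReal_le_ofReal (inv_anti₀ hK hKK')
  refine ⟨h.zero, fun u v hu hv => (h.lip u v (h1 u hu) (h1 v hv)).trans ?_,
    fun x y δ hx hy hδ hxy => (h.inv_lip x y δ (hx.trans_le h2) (hy.trans_le h2) hδ hxy).trans ?_,
    fun x hx => h.right_inv x (hx.trans_le h2), fun u hu => h.left_inv u (h1 u hu)⟩
  · gcongr
  · gcongr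

/-! ### Choice of scale -/

/-- The choice of the scale at which the linear problem is compared with the nonlinear one. -/
theorem exists_scale {θ η K a C d₀ : ℝ} (hθ : θ < 1) (hθ' : 1 / 2 < θ) (hη : 0 < η) (hK : 1 ≤ K)
    (ha : 0 < a) (hC : 0 < C) (hd₀ : 0 < d₀) :
    ∃ B : ℝ, 1 ≤ B ∧ ∀ N : ℝ, 1 ≤ N → ∀ Q : ℝ, B * N ^ ((1 - θ) / η) ≤ Q →
      ∃ s > 0, 3 * K * s < d₀ ∧ N ≤ C * (3 * K * s) ^ (-η) ∧ K ^ 3 * (s * Q ^ 2) ≤ 1 / 8 ∧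
        K ^ 3 * (a * s ^ θ) ≤ 1 / 4 ∧ K ^ 2 * a ^ 2 * s ^ (2 * θ - 1) ≤ 1 / 8 ∧
        a * s ^ (θ - 1) ≤ Q / 4 := by
  have hK0 : 0 < K := by linarith
  have tends : ∀ c r : ℝ, 0 < r → Tendsto (fun s : ℝ => c * s ^ r) (𝓝[>] 0) (𝓝 0) := by
    intro c r hr
    have h1 : ContinuousAt (fun s : ℝ => c * s ^ r) 0 :=
      continuousAt_const.mul (Real.continuousAt_rpow_const _ _ (Or.inr hr.le))
    have h2 := h1.tendsto
    rw [Real.zero_rpow hr.ne', mul_zero] at h2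
    exact h2.mono_left nhdsWithin_le_nhds
  obtain ⟨s₁, ⟨⟨h11, h12⟩, h13⟩, hs₁⟩ : ∃ s₁ : ℝ, ((3 * K * s₁ ^ (1 : ℝ) < d₀ ∧
      K ^ 3 * a * s₁ ^ θ < 1 / 4) ∧ K ^ 2 * a ^ 2 * s₁ ^ (2 * θ - 1) < 1 / 8) ∧ 0 < s₁ :=
    (((((tends (3 * K) 1 one_pos).eventually_lt_const hd₀).and
      ((tends (K ^ 3 * a) θ (by linarith)).eventually_lt_const (by norm_num : (0 : ℝ) < 1 / 4))).and
      ((tends (K ^ 2 * a ^ 2) (2 * θ - 1) (by linarith)).eventually_lt_const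
        (by norm_num : (0 : ℝ) < 1 / 8))).and self_mem_nhdsWithin).exists
  rw [Real.rpow_one] at h11
  set b : ℝ := C ^ (1 / η) / (3 * K) with hb
  have hb0 : 0 < b := by positivity
  set c : ℝ := (8 * K ^ 3)⁻¹ with hc
  have hc0 : 0 < c := by positivity
  -- Chosen so that `Q ≥ B₂` gives `Q ^ (2 * θ - 1) ≥ 4 * a * c ^ (θ - 1)`.
  set B₂ : ℝ := (4 * a * c ^ (θ - 1)) ^ (1 / (2 * θ - 1)) with hB₂
  refine ⟨max (max 1 (4 * a * s₁ ^ (θ - 1))) (max B₂ (4 * a * b ^ (θ - 1))),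
    le_max_of_le_left (le_max_left _ _), ?_⟩
  intro N hN Q hQ
  have hN0 : 0 < N := by linarith
  have hNγ : 1 ≤ N ^ ((1 - θ) / η) := Real.one_le_rpow hN (div_nonneg (by linarith) hη.le)
  have key : ∀ x : ℝ, 0 ≤ x → x ≤ max (max 1 (4 * a * s₁ ^ (θ - 1)))
      (max B₂ (4 * a * b ^ (θ - 1))) → x * N ^ ((1 - θ) / η) ≤ Q ∧ x ≤ Q := by
    intro x hx hxB
    have := (mul_le_mul_of_nonneg_right hxB (by linarith : 0 ≤ N ^ ((1 - θ) / η))).trans hQ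
    exact ⟨this, (le_mul_of_one_le_right hx hNγ).trans this⟩
  have hQ1 : 1 ≤ Q := (key 1 zero_le_one (le_max_of_le_left (le_max_left _ _))).2
  have hQ2 := (key (4 * a * s₁ ^ (θ - 1)) (by positivity)
    (le_max_of_le_left (le_max_right _ _))).2
  have hQ3 := (key B₂ (by positivity) (le_max_of_le_right (le_max_left _ _))).2
  have hQ4 := (key (4 * a * b ^ (θ - 1)) (by positivity)
    (le_max_of_le_right (le_max_right _ _))).1
  have hQ0 : 0 < Q := by linarith
  set s₂ : ℝ := c / Q ^ 2 with hs₂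
  have hs₂0 : 0 < s₂ := by positivity
  set s₃ : ℝ := b * N ^ (-(1 / η)) with hs₃
  have hs₃0 : 0 < s₃ := by positivity
  -- All requirements except the last bound `s` from above, hence the minimum of three thresholds.
  -- The last bounds `s` from below and is checked for whichever threshold is attained.
  set s : ℝ := min s₁ (min s₂ s₃) with hs
  have hs0 : 0 < s := lt_min hs₁ (lt_min hs₂0 hs₃0)
  have le1 : s ≤ s₁ := min_le_left _ _
  have le2 : s ≤ s₂ := (min_le_right _ _).trans (min_le_left _ _)
  have le3 : s ≤ s₃ := (min_le_right _ _).trans (min_le_right _ _)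
  refine ⟨s, hs0, ?_, ?_, ?_, ?_, ?_, ?_⟩
  · exact (mul_le_mul_of_nonneg_left le1 (by positivity)).trans_lt h11
  · have e1 : 3 * K * s ≤ C ^ (1 / η) * N ^ (-(1 / η)) := by
      calc 3 * K * s ≤ 3 * K * s₃ := by gcongr
        _ = _ := by rw [hs₃, hb]; field_simp
    have e2 : (C ^ (1 / η) * N ^ (-(1 / η))) ^ (-η) ≤ (3 * K * s) ^ (-η) :=
      Real.rpow_le_rpow_of_nonpos (by positivity) e1 (by linarith)
    have e3 : (C ^ (1 / η) * N ^ (-(1 / η))) ^ (-η) = C⁻¹ * N := by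
      rw [Real.mul_rpow (by positivity) (by positivity), ← Real.rpow_mul hC.le,
        ← Real.rpow_mul hN0.le]
      have : 1 / η * -η = -1 := by field_simp
      rw [this, show -(1 / η) * -η = 1 by field_simp, Real.rpow_neg_one, Real.rpow_one]
    rw [e3] at e2
    calc N = C * (C⁻¹ * N) := by field_simp
      _ ≤ _ := by gcongr
  · calc K ^ 3 * (s * Q ^ 2) ≤ K ^ 3 * (s₂ * Q ^ 2) := by gcongr
      _ = 1 / 8 := by rw [hs₂, hc]; field_simp
  · rw [← mul_assoc]
    refine le_trans ?_ h12.le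
    have := Real.rpow_le_rpow hs0.le le1 (by linarith : 0 ≤ θ)
    gcongr
  · refine le_trans ?_ h13.le
    have := Real.rpow_le_rpow hs0.le le1 (by linarith : 0 ≤ 2 * θ - 1)
    gcongr
  · suffices 4 * a * s ^ (θ - 1) ≤ Q by linarith
    rcases min_choice s₁ (min s₂ s₃) with h | h
    · rw [hs, h]; exact hQ2
    rcases min_choice s₂ s₃ with h' | h'
    -- Here `s ^ (θ - 1)` is of order `Q ^ (2 - 2 * θ)`, which is beaten by `Q` because `θ > 1/2`.
    · rw [hs, h, h', hs₂, Real.div_rpow hc0.le (by positivity), ← Real.rpow_natCast,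
        ← Real.rpow_mul hQ0.le, div_eq_mul_inv, ← Real.rpow_neg hQ0.le, ← mul_assoc]
      have e : 4 * a * c ^ (θ - 1) ≤ Q ^ (2 * θ - 1) := by
        have := Real.rpow_le_rpow (by positivity) hQ3 (by linarith : 0 ≤ 2 * θ - 1)
        rwa [hB₂, ← Real.rpow_mul (by positivity), one_div_mul_cancel (by linarith),
          Real.rpow_one] at this
      calc _ ≤ Q ^ (2 * θ - 1) * Q ^ (-(((2 : ℕ) : ℝ) * (θ - 1))) := by gcongr
        _ = Q := by
          rw [← Real.rpow_add hQ0]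
          convert Real.rpow_one Q using 2
          push_cast; ring
    -- Here `s ^ (θ - 1)` is of order `N ^ ((1 - θ) / η)`: the growth exponent originates in this
    -- case.
    · rw [hs, h, h', hs₃, Real.mul_rpow hb0.le (by positivity), ← Real.rpow_mul hN0.le, ← mul_assoc]
      convert hQ4 using 3
      ring

/-! ### Bounded solvability of the linear equation -/

section Abstract

variable {E : ℤ → Type*} [∀ k, NormedAddCommGroup (E k)] [∀ k, InnerProductSpace ℝ (E k)]

/-- On the window of length `N` starting at `i`, the inhomogeneous linear equation with right-hand
side bounded by `1` has a solution bounded by `Q`. -/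
def SolvableWithBound (A : ∀ k : ℤ, E k ≃L[ℝ] E (k + 1)) (i : ℤ) (N : ℕ) (Q : ℝ) : Prop :=
  ∀ w : ∀ k : ℤ, E k, (∀ k ∈ Icc (i + 1) (i + N), ‖w k‖ ≤ 1) →
    ∃ v : ∀ k : ℤ, E k,
      (∀ k ∈ Icc i (i + N - 1), v (k + 1) = A k (v k) + w (k + 1)) ∧
      ∀ k ∈ Icc i (i + N), ‖v k‖ ≤ Q

theorem SolvableWithBound.mono {A : ∀ k : ℤ, E k ≃L[ℝ] E (k + 1)} {i : ℤ} {N : ℕ} {Q Q' : ℝ}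
    (h : SolvableWithBound A i N Q) (hQ : Q ≤ Q') : SolvableWithBound A i N Q' := by
  intro w hw
  obtain ⟨v, hv, hvQ⟩ := h w hw
  exact ⟨v, hv, fun k hk => (hvQ k hk).trans hQ⟩

theorem SolvableWithBound.scale {A : ∀ k : ℤ, E k ≃L[ℝ] E (k + 1)} {i : ℤ} {N : ℕ} {Q : ℝ}
    (h : SolvableWithBound A i N Q) {t : ℝ} (ht : 0 < t) (w : ∀ k : ℤ, E k)
    (hw : ∀ k ∈ Icc (i + 1) (i + N), ‖w k‖ ≤ t) :
    ∃ v : ∀ k : ℤ, E k,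
      (∀ k ∈ Icc i (i + N - 1), v (k + 1) = A k (v k) + w (k + 1)) ∧
      ∀ k ∈ Icc i (i + N), ‖v k‖ ≤ t * Q := by
  obtain ⟨v, hv, hvQ⟩ := h (fun k => t⁻¹ • w k) (fun k hk => by
    rw [norm_smul, norm_inv, Real.norm_of_nonneg ht.le, inv_mul_le_iff₀ ht, mul_one]
    exact hw k hk)
  refine ⟨fun k => t • v k, fun k hk => ?_, fun k hk => ?_⟩
  · simp only [hv k hk, smul_add, map_smul, smul_smul, mul_inv_cancel₀ ht.ne', one_smul]
  · rw [norm_smul, Real.norm_of_nonneg ht.le]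
    exact mul_le_mul_of_nonneg_left (hvQ k hk) ht.le

/-- The starting point of the bootstrap: solve forwards from the value `0`. The bound may depend on
the window, since the iteration forgets it. -/
theorem exists_solvableWithBound (A : ∀ k : ℤ, E k ≃L[ℝ] E (k + 1)) (i : ℤ) (N : ℕ) :
    ∃ Q : ℝ, SolvableWithBound A i N Q := by
  induction N with
  | zero =>
    refine ⟨0, fun w _ => ⟨0, fun k hk => ?_, fun k _ => by simp⟩⟩
    simp only [Nat.cast_zero, add_zero, mem_Icc] at hk
    omega
  | succ N ih =>
    obtain ⟨Q, hQ⟩ := ih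
    refine ⟨max Q (‖(A (i + N) : E (i + N) →L[ℝ] E (i + N + 1))‖ * Q + 1), fun w hw => ?_⟩
    obtain ⟨v, hv, hvQ⟩ := hQ w (fun k hk => hw k (by
      simp only [mem_Icc, Nat.cast_add, Nat.cast_one] at hk ⊢; omega))
    refine ⟨Function.update v (i + N + 1) (A (i + N) (v (i + N)) + w (i + N + 1)),
      fun k hk => ?_, fun k hk => ?_⟩
    · simp only [mem_Icc, Nat.cast_add, Nat.cast_one] at hk
      rw [Function.update_of_ne (show k ≠ i + N + 1 by omega)]
      by_cases h : k = i + N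
      · subst h
        simp
      · rw [Function.update_of_ne (by omega)]
        exact hv k (by simp only [mem_Icc]; omega)
    · simp only [mem_Icc, Nat.cast_add, Nat.cast_one] at hk
      by_cases h : k = i + N + 1
      · subst h
        rw [Function.update_self]
        refine le_max_of_le_right ((norm_add_le _ _).trans ?_)
        have h1 : ‖A (i + N) (v (i + N))‖ ≤ ‖(A (i + N) : E (i + N) →L[ℝ] E (i + N + 1))‖ * Q :=
          ((A (i + N) : E (i + N) →L[ℝ] E (i + N + 1)).le_opNorm _).trans
            (mul_le_mul_of_nonneg_left (hvQ _ (by simp)) (norm_nonneg _))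
        have h2 := hw (i + N + 1) (by simp only [mem_Icc, Nat.cast_add, Nat.cast_one]; omega)
        linarith
      · rw [Function.update_of_ne h]
        exact le_max_of_le_left (hvQ k (by simp only [mem_Icc]; omega))

end Abstract

/-! ### From shadowing to slow growth -/

section Abstract

variable {E : ℤ → Type*} [∀ k, NormedAddCommGroup (E k)] [∀ k, InnerProductSpace ℝ (E k)]

/-- A pseudotrajectory on `[0, N]` extends to all larger times by iteration. -/
theorem exists_isPseudotrajectory_extension {M : Type*} [EMetricSpace M] (f : M → M) {d : ℝ}
    (hd : 0 < d) (T : ℝ) (i : ℤ) (N : ℕ) (Y : ℤ → M)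
    (hY : ∀ k ∈ Icc i (i + N - 1), edist (Y (k + 1)) (f (Y k)) < ENNReal.ofReal d) :
    ∃ y : ℤ → M, IsPseudotrajectory f d (timeWindow T) y ∧ ∀ k ∈ Icc i (i + N), y (k - i) = Y k := by
  have hy : ∃ y : ℤ → M, (∀ j : ℤ, j ≤ N → y j = Y (i + j)) ∧
      ∀ j : ℤ, N ≤ j → y j = f^[(j - N).toNat] (Y (i + N)) := by
    refine ⟨fun j => if j ≤ N then Y (i + j) else f^[(j - N).toNat] (Y (i + N)),
      fun j hj => if_pos hj, fun j hj => ?_⟩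
    rcases hj.eq_or_lt with rfl | h
    · simp
    · exact if_neg (not_le.2 h)
  obtain ⟨y, hy1, hy2⟩ := hy
  refine ⟨y, fun k hk _ => ?_, fun k hk => ?_⟩
  · have hk0 := hk.1
    rcases lt_or_ge k (N : ℤ) with h | h
    · rw [hy1 _ (by omega), hy1 _ h.le, ← add_assoc]
      exact hY _ (by simp only [mem_Icc]; omega)
    · rw [hy2 _ (by omega), hy2 _ h, show (k + 1 - N).toNat = (k - N).toNat + 1 by omega,
        Function.iterate_succ_apply', edist_self]
      exact ENNReal.ofReal_pos.2 hd
  · rw [mem_Icc] at hk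
    rw [hy1 _ (by omega), add_sub_cancel]

variable {M : Type*} [EMetricSpace M] {f : M → M} {K : ℝ} {A : ∀ k : ℤ, E k ≃L[ℝ] E (k + 1)}
  {p : ℤ → M} {φ : ∀ k, E k → M} {ψ : ∀ k, M → E k}

/-- Shadowing of the pseudotrajectory obtained from a solution of the linear equation gives a better
solution of the linear equation. -/
theorem SolvableWithBound.improve (hK : 1 ≤ K)
    (hφ : ∀ k, IsLipschitzParam K (p k) (φ k) (ψ k)) (hA : ∀ k u, ‖A k u‖ ≤ K * ‖u‖)
    (hf : ∀ k u, K * ‖u‖ ≤ 1 →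
      edist (f (φ k u)) (φ (k + 1) (A k u)) ≤ ENNReal.ofReal (K * ‖u‖ ^ 2))
    {i : ℤ} {N : ℕ} {Q s δ T : ℝ} (hs : 0 < s) (hδ : 0 < δ) (hQ1 : 1 ≤ Q) (hNT : N ≤ T)
    (hsh : ∀ y : ℤ → M, IsPseudotrajectory f (3 * K * s) (timeWindow T) y →
      ∃ x : ℤ → M, IsTrajectory f (timeWindow T) x ∧
        ∀ k ∈ timeWindow T, edist (x k) (y k) < ENNReal.ofReal δ)
    (hsQ : K ^ 3 * (s * Q ^ 2) ≤ 1 / 8) (hKδ : K ^ 3 * (K * δ) ≤ 1 / 4)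
    (h : SolvableWithBound A i N Q) :
    SolvableWithBound A i N ((K * δ + K ^ 2 * (s * Q + K * δ) ^ 2 * Q) / s) := by
  have hK0 : 0 < K := by linarith
  have hK2 : 1 ≤ K ^ 2 := one_le_pow₀ hK
  have hK3 : K ≤ K ^ 3 := le_self_pow₀ hK (by norm_num)
  have hK23 : K ^ 2 ≤ K ^ 3 := pow_le_pow_right₀ hK (by norm_num)
  have hsQQ : s * Q ≤ s * Q ^ 2 := by gcongr; exact le_self_pow₀ hQ1 (by norm_num)
  have hsQ0 : 0 < s * Q := by positivity
  have hKsQ2 : K ^ 3 * (s * Q) ≤ 1 / 8 := (by gcongr : K ^ 3 * (s * Q) ≤ _).trans hsQ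
  have hb2 : K ^ 2 * (s * Q) ≤ 1 / 8 := (by gcongr : K ^ 2 * (s * Q) ≤ _).trans hKsQ2
  have hb1 : K * (s * Q) ≤ 1 / 8 := (by gcongr : K * (s * Q) ≤ _).trans hKsQ2
  set e : ℝ := s * Q + K * δ with he
  have he0 : 0 < e := by positivity
  have he3 : K ^ 3 * e < 1 := by rw [he, mul_add]; linarith
  have he2 : K ^ 2 * e < 1 := (by gcongr : K ^ 2 * e ≤ _).trans_lt he3
  have he1 : K * e < 1 := (by gcongr : K * e ≤ _).trans_lt he3
  intro w hw
  obtain ⟨v, hv, hvQ⟩ := h w hw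
  have hsv : ∀ k ∈ Icc i (i + N), ‖s • v k‖ ≤ s * Q := fun k hk => by
    rw [norm_smul, Real.norm_of_nonneg hs.le]
    exact mul_le_mul_of_nonneg_left (hvQ k hk) hs.le
  have hsv1 : ∀ k ∈ Icc i (i + N), K * ‖s • v k‖ ≤ 1 := fun k hk =>
    (mul_le_mul_of_nonneg_left (hsv k hk) hK0.le).trans (by linarith)
  -- The right-hand side `s • w` and the nonlinearity `K * (s * Q) ^ 2` each contribute at most `K *
  -- s`; the factor `3` leaves room for strictness.
  obtain ⟨y, hy, hyY⟩ := exists_isPseudotrajectory_extension f (d := 3 * K * s) (by positivity) T i N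
    (fun k => φ k (s • v k)) (fun k hk => by
      have hk1 : k ∈ Icc i (i + N) := by simp only [mem_Icc] at hk ⊢; omega
      have hk2 : k + 1 ∈ Icc i (i + N) := by simp only [mem_Icc] at hk ⊢; omega
      have hk3 : k + 1 ∈ Icc (i + 1) (i + N) := by simp only [mem_Icc] at hk ⊢; omega
      have e1 : edist (φ (k + 1) (s • v (k + 1))) (φ (k + 1) (A k (s • v k))) ≤
          ENNReal.ofReal (K * s) := by
        refine ((hφ (k + 1)).lip _ _ (hsv1 _ hk2) ?_).trans (ENNReal.ofReal_le_ofReal ?_)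
        · calc K * ‖A k (s • v k)‖ ≤ K * (K * (s * Q)) := by
                gcongr; exact (hA k _).trans (by gcongr; exact hsv k hk1)
            _ = K ^ 2 * (s * Q) := by ring
            _ ≤ 1 := by linarith
        · rw [hv k hk, map_smul, ← smul_sub, add_sub_cancel_left, norm_smul,
            Real.norm_of_nonneg hs.le]
          have := hw _ hk3
          gcongr
          exact mul_le_of_le_one_right hs.le this
      have e2 : edist (f (φ k (s • v k))) (φ (k + 1) (A k (s • v k))) ≤
          ENNReal.ofReal (K * s) := by
        refine (hf k _ (hsv1 k hk1)).trans (ENNReal.ofReal_le_ofReal ?_)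
        gcongr
        calc ‖s • v k‖ ^ 2 ≤ (s * Q) ^ 2 := by gcongr; exact hsv k hk1
          _ = s * (s * Q ^ 2) := by ring
          _ ≤ s * 1 := by
            gcongr
            have : s * Q ^ 2 ≤ K ^ 3 * (s * Q ^ 2) :=
              le_mul_of_one_le_left (by positivity) (by linarith)
            linarith
          _ = s := mul_one s
      rw [edist_comm] at e2
      calc edist (φ (k + 1) (s • v (k + 1))) (f (φ k (s • v k)))
          ≤ ENNReal.ofReal (K * s) + ENNReal.ofReal (K * s) :=
            (edist_triangle _ _ _).trans (add_le_add e1 e2)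
        _ = ENNReal.ofReal (K * s + K * s) := (ENNReal.ofReal_add (by positivity)
            (by positivity)).symm
        _ < ENNReal.ofReal (3 * K * s) := by
          have : 0 < K * s := by positivity
          exact (ENNReal.ofReal_lt_ofReal_iff (by positivity)).2 (by linarith))
  obtain ⟨x, hx, hxy⟩ := hsh y hy
  have hwin : ∀ k ∈ Icc i (i + N), k - i ∈ timeWindow T := by
    intro k hk
    rw [mem_Icc] at hk
    refine ⟨by omega, le_trans ?_ hNT⟩
    exact_mod_cast (by omega : k - i ≤ N)
  have hxY : ∀ k ∈ Icc i (i + N), edist (x (k - i)) (φ k (s • v k)) ≤ ENNReal.ofReal δ :=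
    fun k hk => by
      have := (hxy _ (hwin k hk)).le
      rwa [hyY k hk] at this
  have hnear : ∀ k (u : E k), K ^ 2 * ‖u‖ < 1 →
      edist (φ k u) (p k) < ENNReal.ofReal K⁻¹ := by
    intro k u hu
    have h1 : K * ‖u‖ ≤ 1 := (by
      gcongr; exact le_self_pow₀ hK (by norm_num) : K * ‖u‖ ≤ K ^ 2 * ‖u‖).trans hu.le
    have := (hφ k).lip u 0 h1 (by simp)
    rw [(hφ k).zero, sub_zero] at this
    refine this.trans_lt ((ENNReal.ofReal_lt_ofReal_iff (by positivity)).2 ?_)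
    rw [← one_div, lt_div_iff₀ hK0]
    linarith [show K * ‖u‖ * K = K ^ 2 * ‖u‖ by ring]
  have hxp : ∀ k ∈ Icc i (i + N), edist (x (k - i)) (p k) < ENNReal.ofReal K⁻¹ := by
    intro k hk
    have h2 := (hφ k).lip (s • v k) 0 (hsv1 k hk) (by simp)
    rw [(hφ k).zero, sub_zero] at h2
    have h3 : edist (φ k (s • v k)) (p k) ≤ ENNReal.ofReal (K * (s * Q)) :=
      h2.trans (ENNReal.ofReal_le_ofReal (by gcongr; exact hsv k hk))
    refine ((edist_triangle _ _ _).trans (add_le_add (hxY k hk) h3)).trans_lt ?_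
    rw [← ENNReal.ofReal_add hδ.le (by positivity), ENNReal.ofReal_lt_ofReal_iff (by positivity),
      ← one_div, lt_div_iff₀ hK0]
    have : K * δ ≤ K ^ 3 * (K * δ) := le_mul_of_one_le_left (by positivity) (by linarith)
    linarith [show (δ + K * (s * Q)) * K = K * δ + K ^ 2 * (s * Q) by ring]
  have hsvn : ∀ k ∈ Icc i (i + N), K ^ 2 * ‖s • v k‖ < 1 := fun k hk =>
    (mul_le_mul_of_nonneg_left (hsv k hk) (by positivity)).trans_lt (by linarith)
  -- The shadowing trajectory in coordinates; its clock starts at `0`, that of the window at `i`.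
  set c : ∀ k : ℤ, E k := fun k => ψ k (x (k - i)) with hc
  have hcv : ∀ k ∈ Icc i (i + N), ‖c k - s • v k‖ ≤ K * δ := by
    intro k hk
    have := (hφ k).inv_lip _ _ δ (hxp k hk) (hnear k _ (hsvn k hk)) hδ.le (hxY k hk)
    rwa [(hφ k).left_inv _ (hsv1 k hk)] at this
  have hce : ∀ k ∈ Icc i (i + N), ‖c k‖ ≤ e := by
    intro k hk
    calc ‖c k‖ = ‖s • v k + (c k - s • v k)‖ := by rw [add_sub_cancel]
      _ ≤ s * Q + K * δ := (norm_add_le _ _).trans (add_le_add (hsv k hk) (hcv k hk))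
  have hct : ∀ k ∈ Icc i (i + N - 1), ‖c (k + 1) - A k (c k)‖ ≤ K ^ 2 * e ^ 2 := by
    intro k hk
    have hk1 : k ∈ Icc i (i + N) := by simp only [mem_Icc] at hk ⊢; omega
    have hk2 : k + 1 ∈ Icc i (i + N) := by simp only [mem_Icc] at hk ⊢; omega
    have hxx : x (k + 1 - i) = f (x (k - i)) := by
      rw [show k + 1 - i = k - i + 1 by ring]
      refine hx _ (hwin k hk1) ?_
      rw [show k - i + 1 = k + 1 - i by ring]
      exact hwin _ hk2
    have hxc : φ k (c k) = x (k - i) := (hφ k).right_inv _ (hxp k hk1)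
    have hc1 : K * ‖c k‖ ≤ 1 := (mul_le_mul_of_nonneg_left (hce k hk1) hK0.le).trans he1.le
    have hAc : ‖A k (c k)‖ ≤ K * e := (hA k _).trans (by gcongr; exact hce k hk1)
    have hAc1 : K ^ 2 * ‖A k (c k)‖ < 1 := by
      refine lt_of_le_of_lt ?_ he3
      calc K ^ 2 * ‖A k (c k)‖ ≤ K ^ 2 * (K * e) := by gcongr
        _ = K ^ 3 * e := by ring
    have h1 : edist (x (k + 1 - i)) (φ (k + 1) (A k (c k))) ≤ ENNReal.ofReal (K * e ^ 2) := by
      rw [hxx, ← hxc]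
      exact (hf k _ hc1).trans (ENNReal.ofReal_le_ofReal (by gcongr; exact hce k hk1))
    have h2 := (hφ (k + 1)).inv_lip _ _ _ (hxp _ hk2) (hnear _ _ hAc1) (by positivity) h1
    have h3 : K * ‖A k (c k)‖ ≤ 1 := by
      calc K * ‖A k (c k)‖ ≤ K * (K * e) := by gcongr
        _ = K ^ 2 * e := by ring
        _ ≤ 1 := he2.le
    rw [(hφ (k + 1)).left_inv _ h3] at h2
    calc _ ≤ K * (K * e ^ 2) := h2
      _ = K ^ 2 * e ^ 2 := by ring
  -- The defect at `k` comes from the index `k - 1`, so it must be transported to `E k`.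
  have hshift : ∀ k : ℤ, ∃ t : E k, ∀ j (hj : j + 1 = k), t = hj ▸ (c (j + 1) - A j (c j)) := by
    intro k
    obtain ⟨j, rfl⟩ : ∃ j, k = j + 1 := ⟨k - 1, by ring⟩
    refine ⟨c (j + 1) - A j (c j), fun j' hj' => ?_⟩
    obtain rfl : j' = j := by omega
    rfl
  choose t ht using hshift
  have ht' : ∀ k, t (k + 1) = c (k + 1) - A k (c k) := fun k => ht _ k rfl
  obtain ⟨z, hz, hzQ⟩ := h.scale (t := K ^ 2 * e ^ 2) (by positivity) t (fun k hk => by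
    obtain ⟨j, rfl⟩ : ∃ j, k = j + 1 := ⟨k - 1, by ring⟩
    rw [ht']
    exact hct j (by simp only [mem_Icc] at hk ⊢; omega))
  -- `c - z` solves the homogeneous equation and is close to `s • v`, so subtracting it preserves
  -- the right-hand side.
  refine ⟨fun k => s⁻¹ • (s • v k - c k + z k), fun k hk => ?_, fun k hk => ?_⟩
  · simp only [hz k hk, hv k hk, ht', map_smul, map_add, map_sub, smul_add, smul_sub, smul_smul,
      inv_mul_cancel₀ hs.ne', one_smul]
    abel
  · rw [norm_smul, norm_inv, Real.norm_of_nonneg hs.le, inv_mul_eq_div]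
    gcongr
    refine (norm_add_le _ _).trans (add_le_add ?_ (hzQ k hk))
    rw [norm_sub_rev]
    exact hcv k hk

/-- Finite Hölder shadowing implies slow growth for every linear cocycle which approximates the
dynamics to second order in Lipschitz parametrizations along a sequence of points; the constant
depends only on the constants of the parametrizations. -/
theorem FinHolSh.exists_slowGrowth_bound {θ η : ℝ} (hsh : FinHolSh f θ η) (hθ : θ < 1)
    (hθ' : 1 / 2 < θ) (hη : 0 < η) (hK : 1 ≤ K) :
    ∃ B > (0 : ℝ), ∀ (E : ℤ → Type*) [∀ k, NormedAddCommGroup (E k)]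
      [∀ k, InnerProductSpace ℝ (E k)] (A : ∀ k : ℤ, E k ≃L[ℝ] E (k + 1))
      (p : ℤ → M) (φ : ∀ k, E k → M) (ψ : ∀ k, M → E k),
      (∀ k, IsLipschitzParam K (p k) (φ k) (ψ k)) → (∀ k u, ‖A k u‖ ≤ K * ‖u‖) →
      (∀ k u, K * ‖u‖ ≤ 1 →
        edist (f (φ k u)) (φ (k + 1) (A k u)) ≤ ENNReal.ofReal (K * ‖u‖ ^ 2)) →
      ∀ (i : ℤ) (N : ℕ), 0 < N → SolvableWithBound A i N (B * (N : ℝ) ^ ((1 - θ) / η)) := by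
  have hK0 : 0 < K := by linarith
  obtain ⟨d₀, hd₀, L, hL, C, hC, hsh⟩ := hsh
  obtain ⟨B, hB1, hB⟩ := exists_scale (a := K * (L * (3 * K) ^ θ)) hθ hθ' hη hK (by positivity)
    hC hd₀
  refine ⟨B, by linarith, fun E _ _ A p φ ψ hφ hA hf i N hN => ?_⟩
  have hN1 : (1 : ℝ) ≤ N := by exact_mod_cast hN
  have hR1 : 1 ≤ B * (N : ℝ) ^ ((1 - θ) / η) :=
    one_le_mul_of_one_le_of_one_le hB1
      (Real.one_le_rpow hN1 (div_nonneg (by linarith) hη.le))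
  have step : ∀ Q, B * (N : ℝ) ^ ((1 - θ) / η) ≤ Q → SolvableWithBound A i N Q →
      SolvableWithBound A i N (3 / 4 * Q) := by
    intro Q hQ h
    have hQ1 : 1 ≤ Q := hR1.trans hQ
    obtain ⟨s, hs, h1, h2, h3, h4, h5, h6⟩ := hB N hN1 Q hQ
    have hδ : K * (L * (3 * K * s) ^ θ) = K * (L * (3 * K) ^ θ) * s ^ θ := by
      rw [Real.mul_rpow (by positivity) hs.le]; ring
    refine (h.improve (δ := L * (3 * K * s) ^ θ) hK hφ hA hf hs (by positivity) hQ1 h2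
      (fun y hy => hsh _ (by positivity) h1 y hy) h3 (by rw [hδ]; exact h4)).mono ?_
    -- The budget: `Q / 4` from the shadowing distance and `Q / 2` from the quadratic correction.
    rw [hδ, div_le_iff₀ hs]
    set a := K * (L * (3 * K) ^ θ)
    have ha : 0 < a := by positivity
    have e1 : s ^ (2 * θ - 1) * s = (s ^ θ) ^ 2 := by
      rw [← Real.rpow_natCast, ← Real.rpow_mul hs.le]
      nth_rw 2 [← Real.rpow_one s]
      rw [← Real.rpow_add hs]
      congr 1
      push_cast; ring
    have e2 : s ^ (θ - 1) * s = s ^ θ := by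
      nth_rw 2 [← Real.rpow_one s]
      rw [← Real.rpow_add hs]
      congr 1
      ring
    have f1 : a * s ^ θ ≤ Q / 4 * s := by
      rw [← e2, ← mul_assoc]; gcongr
    have f2 : K ^ 2 * (a * s ^ θ) ^ 2 ≤ 1 / 8 * s := by
      calc K ^ 2 * (a * s ^ θ) ^ 2 = K ^ 2 * a ^ 2 * s ^ (2 * θ - 1) * s := by
            rw [mul_assoc _ _ s, e1]; ring
        _ ≤ _ := by gcongr
    have f3 : K ^ 2 * (s * Q) ^ 2 ≤ 1 / 8 * s := by
      calc K ^ 2 * (s * Q) ^ 2 = K ^ 2 * (s * Q ^ 2) * s := by ring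
        _ ≤ K ^ 3 * (s * Q ^ 2) * s := by
          gcongr
          norm_num
        _ ≤ _ := by gcongr
    have f4 : (s * Q + a * s ^ θ) ^ 2 ≤ 2 * (s * Q) ^ 2 + 2 * (a * s ^ θ) ^ 2 := add_sq_le.trans
      (by linarith)
    have f5 : K ^ 2 * (s * Q + a * s ^ θ) ^ 2 ≤ 1 / 2 * s := by
      calc K ^ 2 * (s * Q + a * s ^ θ) ^ 2
          ≤ K ^ 2 * (2 * (s * Q) ^ 2 + 2 * (a * s ^ θ) ^ 2) := by gcongr
        _ ≤ _ := by linarith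
    have f6 : K ^ 2 * (s * Q + a * s ^ θ) ^ 2 * Q ≤ 1 / 2 * s * Q := by gcongr
    linarith
  obtain ⟨Q₀, hQ₀⟩ := exists_solvableWithBound A i N
  -- If the target bound fails, no attained bound lies below it, so `step` applies forever and the
  -- bounds tend to `0`.
  by_contra hcon
  have iter : ∀ n : ℕ, SolvableWithBound A i N ((3 / 4) ^ n * Q₀) := by
    intro n
    induction n with
    | zero => simpa using hQ₀
    | succ n ih =>
      have := step _ (le_of_not_ge fun hle => hcon (ih.mono hle)) ih
      rwa [← mul_assoc, ← pow_succ'] at this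
  have lim : Tendsto (fun n : ℕ => (3 / 4 : ℝ) ^ n * Q₀) atTop (𝓝 0) := by
    simpa using (tendsto_pow_atTop_nhds_zero_of_lt_one (r := (3 / 4 : ℝ)) (by norm_num)
      (by norm_num)).mul_const Q₀
  obtain ⟨n, hn⟩ := (lim.eventually_lt_const (by linarith :
    0 < B * (N : ℝ) ^ ((1 - θ) / η))).exists
  exact hcon ((iter n).mono hn.le)

end Abstract

/-! ### Charts are locally bi-Lipschitz for the Riemannian distance -/

section Chart

open Manifold MeasureTheory Metric
open scoped NNReal ENNReal

variable {F : Type*} [NormedAddCommGroup F] [NormedSpace ℝ F]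
  {M : Type*} [EMetricSpace M] [ChartedSpace F M] [IsManifold 𝓘(ℝ, F) 1 M]
  [RiemannianBundle (fun x : M => TangentSpace 𝓘(ℝ, F) x)]
  [IsContinuousRiemannianBundle F (fun x : M => TangentSpace 𝓘(ℝ, F) x)]

/-- The derivative at `y` of the chart centered at `a`, with values in the model space. -/
def chartDeriv (a y : M) : TangentSpace 𝓘(ℝ, F) y →L[ℝ] F :=
  mfderiv 𝓘(ℝ, F) 𝓘(ℝ, F) (extChartAt 𝓘(ℝ, F) a) y

/-- The chart derivative is the trivialization of the tangent bundle, locally bounded for a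
continuous metric. -/
theorem exists_norm_mfderiv_extChartAt_le (a : M) :
    ∃ C : ℝ≥0, ∀ᶠ y in 𝓝 a, ∀ v : TangentSpace 𝓘(ℝ, F) y,
      ‖chartDeriv a y v‖ₑ ≤ C * ‖v‖ₑ := by
  obtain ⟨C, hC0, hC⟩ :=
    eventually_norm_trivializationAt_lt F (fun x : M => TangentSpace 𝓘(ℝ, F) x) a
  lift C to ℝ≥0 using hC0.le
  refine ⟨C, ?_⟩
  filter_upwards [hC, chart_source_mem_nhds F a] with y hy h'y v
  rw [chartDeriv, ← TangentBundle.continuousLinearMapAt_trivializationAt h'y]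
  have := ((trivializationAt F (TangentSpace 𝓘(ℝ, F)) a).continuousLinearMapAt ℝ y).le_opNorm v
  have h2 := this.trans (mul_le_mul_of_nonneg_right hy.le (norm_nonneg v))
  rw [enorm_eq_nnnorm, enorm_eq_nnnorm]
  exact_mod_cast h2

theorem exists_norm_mfderiv_extChartAt_symm_le (a : M) :
    ∃ C : ℝ≥0, ∀ᶠ z in 𝓝 (extChartAt 𝓘(ℝ, F) a a), ∀ v : F,
      ‖mfderiv 𝓘(ℝ, F) 𝓘(ℝ, F) (extChartAt 𝓘(ℝ, F) a).symm z v‖ₑ ≤ C * ‖v‖ₑ := by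
  obtain ⟨C, hC0, hC⟩ :=
    eventually_norm_symmL_trivializationAt_lt F (fun x : M => TangentSpace 𝓘(ℝ, F) x) a
  lift C to ℝ≥0 using hC0.le
  refine ⟨C, ?_⟩
  have h1 : ContinuousAt (extChartAt 𝓘(ℝ, F) a).symm (extChartAt 𝓘(ℝ, F) a a) :=
    continuousAt_extChartAt_symm a
  have h2 := h1.tendsto
  rw [extChartAt_to_inv] at h2
  filter_upwards [h2.eventually hC, extChartAt_target_mem_nhds a] with z hz h'z v
  have hs : (extChartAt 𝓘(ℝ, F) a).symm z ∈ (chartAt F a).source := by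
    rw [← extChartAt_source 𝓘(ℝ, F)]; exact (extChartAt 𝓘(ℝ, F) a).map_target h'z
  rw [TangentBundle.symmL_trivializationAt hs, (extChartAt 𝓘(ℝ, F) a).right_inv h'z] at hz
  simp only [modelWithCornersSelf_coe, range_id, mfderivWithin_univ] at hz
  have := ContinuousLinearMap.le_opNorm (𝕜 := ℝ) (𝕜₂ := ℝ) (E := F)
    (F := TangentSpace 𝓘(ℝ, F) ((extChartAt 𝓘(ℝ, F) a).symm z)) 
    (mfderiv 𝓘(ℝ, F) 𝓘(ℝ, F) (extChartAt 𝓘(ℝ, F) a).symm z) v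
  have h2 := this.trans (mul_le_mul_of_nonneg_right hz.le (norm_nonneg v))
  rw [enorm_eq_nnnorm, enorm_eq_nnnorm]
  exact_mod_cast h2

/-- The inverse chart maps a straight segment to a path, whose length bounds the distance. -/
theorem exists_edist_extChartAt_symm_le [IsRiemannianManifold 𝓘(ℝ, F) M] (a : M) :
    ∃ C : ℝ≥0, ∃ r > 0, ball (extChartAt 𝓘(ℝ, F) a a) r ⊆ (extChartAt 𝓘(ℝ, F) a).target ∧
      ∀ x ∈ ball (extChartAt 𝓘(ℝ, F) a a) r, ∀ y ∈ ball (extChartAt 𝓘(ℝ, F) a a) r,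
        edist ((extChartAt 𝓘(ℝ, F) a).symm x) ((extChartAt 𝓘(ℝ, F) a).symm y) ≤ C * edist x y := by
  obtain ⟨C, hC⟩ := exists_norm_mfderiv_extChartAt_symm_le (F := F) a
  obtain ⟨r, hr, hball⟩ := Metric.mem_nhds_iff.1 (inter_mem (extChartAt_target_mem_nhds a) hC)
  refine ⟨C, r, hr, hball.trans inter_subset_left, fun x hx y hy => ?_⟩
  set η := ContinuousAffineMap.lineMap (R := ℝ) x y with hη
  have hmaps : ∀ t ∈ Icc (0 : ℝ) 1, η t ∈ ball (extChartAt 𝓘(ℝ, F) a a) r := by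
    intro t ht
    apply (convex_ball _ _).segment_subset hx hy
    rw [segment_eq_image_lineMap]
    exact ⟨t, ht, rfl⟩
  have η_smooth : ContMDiff 𝓘(ℝ, ℝ) 𝓘(ℝ, F) 1 η := by
    rw [contMDiff_iff_contDiff]
    exact ContinuousAffineMap.contDiff _
  set γ := (extChartAt 𝓘(ℝ, F) a).symm ∘ η with hγ
  have hγs : ContMDiffOn 𝓘(ℝ, ℝ) 𝓘(ℝ, F) 1 γ (Icc 0 1) :=
    (contMDiffOn_extChartAt_symm a).comp η_smooth.contMDiffOn fun t ht =>
      (hball (hmaps t ht)).1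
  rw [IsRiemannianManifold.out (I := 𝓘(ℝ, F))]
  refine (riemannianEDist_le_pathELength hγs (by simp [γ, η, ContinuousAffineMap.coe_lineMap_eq])
    (by simp [γ, η, ContinuousAffineMap.coe_lineMap_eq]) zero_le_one).trans ?_
  rw [← lintegral_fderiv_lineMap_eq_edist, pathELength_eq_lintegral_mfderivWithin_Icc,
    ← lintegral_const_mul' _ _ ENNReal.coe_ne_top]
  refine setLIntegral_mono' measurableSet_Icc fun t ht => ?_
  have hd : MDifferentiableAt 𝓘(ℝ, F) 𝓘(ℝ, F) (extChartAt 𝓘(ℝ, F) a).symm (η t) := by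
    have := mdifferentiableWithinAt_extChartAt_symm (I := 𝓘(ℝ, F)) (x := a) (hball (hmaps t ht)).1
    simpa [mdifferentiableWithinAt_univ] using this
  have e : mfderivWithin 𝓘(ℝ, ℝ) 𝓘(ℝ, F) γ (Icc 0 1) t =
      (mfderiv 𝓘(ℝ, F) 𝓘(ℝ, F) (extChartAt 𝓘(ℝ, F) a).symm (η t)) ∘L
        (mfderivWithin 𝓘(ℝ, ℝ) 𝓘(ℝ, F) η (Icc 0 1) t) :=
    mfderiv_comp_mfderivWithin t hd ((η_smooth.mdifferentiable one_ne_zero t).mdifferentiableWithinAt)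
      (by rw [uniqueMDiffWithinAt_iff_uniqueDiffWithinAt]; exact uniqueDiffOn_Icc zero_lt_one t ht)
  rw [show mfderivWithin 𝓘(ℝ, ℝ) 𝓘(ℝ, F) γ (Icc 0 1) t 1 =
    mfderiv 𝓘(ℝ, F) 𝓘(ℝ, F) (extChartAt 𝓘(ℝ, F) a).symm (η t)
      (mfderivWithin 𝓘(ℝ, ℝ) 𝓘(ℝ, F) η (Icc 0 1) t 1) from congr($e 1),
    mfderivWithin_eq_fderivWithin]
  exact (hball (hmaps t ht)).2 _

/-- A nearly minimizing path between points close to `a` stays in the chart domain, where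
integrating the bound on the chart derivative controls the displacement. -/
theorem exists_edist_extChartAt_le [IsRiemannianManifold 𝓘(ℝ, F) M] (a : M) :
    ∃ C : ℝ≥0, ∃ r : ℝ≥0, 0 < r ∧
      eball a r ⊆ (extChartAt 𝓘(ℝ, F) a).source ∧
      ∀ x ∈ eball a r, ∀ y ∈ eball a r,
        edist (extChartAt 𝓘(ℝ, F) a x) (extChartAt 𝓘(ℝ, F) a y) ≤ C * edist x y := by
  obtain ⟨C, hC⟩ := exists_norm_mfderiv_extChartAt_le (F := F) a
  obtain ⟨r₀, hr₀, hball₀⟩ := EMetric.mem_nhds_iff.1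
    (inter_mem (extChartAt_source_mem_nhds (I := 𝓘(ℝ, F)) a) hC)
  obtain ⟨r, hr, hrr⟩ := ENNReal.lt_iff_exists_nnreal_btwn.1 hr₀
  have hr0 : 0 < r := by exact_mod_cast hr
  have hball := (eball_subset_eball hrr.le).trans hball₀
  -- Points of the ball of radius `r / 3` are joined by paths of length below `2 * r / 3`, which do
  -- not leave the ball of radius `r`.
  have hsub : eball a ((r / 3 : ℝ≥0) : ℝ≥0∞) ⊆ eball a r :=
    eball_subset_eball (by exact_mod_cast div_le_self r.2 (by norm_num))
  refine ⟨C, r / 3, by positivity, (hsub.trans hball).trans inter_subset_left,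
    fun x hx y hy => ?_⟩
  have hxy : edist x y < ((2 * (r / 3) : ℝ≥0) : ℝ≥0∞) := by
    rw [mem_eball] at hx hy
    rw [edist_comm] at hy
    calc edist x y ≤ edist x a + edist a y := edist_triangle _ _ _
      _ < ((r / 3 : ℝ≥0) : ℝ≥0∞) + ((r / 3 : ℝ≥0) : ℝ≥0∞) := ENNReal.add_lt_add hx hy
      _ = _ := by rw [← ENNReal.coe_add, two_mul]
  -- The infimum defining the distance need not be attained, so the bound is proved for every
  -- slightly larger `b`, then passed to the limit.
  have main : ∀ b, edist x y < b → b ≤ ((2 * (r / 3) : ℝ≥0) : ℝ≥0∞) →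
      edist (extChartAt 𝓘(ℝ, F) a x) (extChartAt 𝓘(ℝ, F) a y) ≤ C * b := by
    intro b hb hbr
    rw [IsRiemannianManifold.out (I := 𝓘(ℝ, F))] at hb
    obtain ⟨γ, hγ0, hγ1, hγs, hγb⟩ := exists_lt_of_riemannianEDist_lt hb
    have hmaps : ∀ t ∈ Icc (0 : ℝ) 1, γ t ∈ eball a r := by
      intro t ht
      have h1 : edist x (γ t) < ((2 * (r / 3) : ℝ≥0) : ℝ≥0∞) := by
        rw [IsRiemannianManifold.out (I := 𝓘(ℝ, F))]
        refine (riemannianEDist_le_pathELength (hγs.mono (Icc_subset_Icc_right ht.2)) hγ0 rfl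
          ht.1).trans_lt (lt_of_le_of_lt ?_ (hγb.trans_le hbr))
        exact pathELength_mono le_rfl ht.2
      rw [mem_eball, edist_comm]
      rw [mem_eball, edist_comm] at hx
      calc edist a (γ t) ≤ edist a x + edist x (γ t) := edist_triangle _ _ _
        _ < ((r / 3 : ℝ≥0) : ℝ≥0∞) + ((2 * (r / 3) : ℝ≥0) : ℝ≥0∞) := ENNReal.add_lt_add hx h1
        _ = r := by rw [← ENNReal.coe_add]; congr 1; ring
    have hsrc : ∀ t ∈ Icc (0 : ℝ) 1, γ t ∈ (chartAt F a).source := fun t ht => by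
      rw [← extChartAt_source 𝓘(ℝ, F)]; exact (hball (hmaps t ht)).1
    set γ' := extChartAt 𝓘(ℝ, F) a ∘ γ with hγ'
    have hs' : ContMDiffOn 𝓘(ℝ, ℝ) 𝓘(ℝ, F) 1 γ' (Icc 0 1) :=
      contMDiffOn_extChartAt.comp (t := (chartAt F a).source) hγs hsrc
    calc edist (extChartAt 𝓘(ℝ, F) a x) (extChartAt 𝓘(ℝ, F) a y)
        = ‖γ' 1 - γ' 0‖ₑ := by
          rw [edist_comm, edist_eq_enorm_sub, hγ', Function.comp_apply, Function.comp_apply, hγ0,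
            hγ1]
      _ ≤ ∫⁻ t in Icc 0 1, ‖derivWithin γ' (Icc 0 1) t‖ₑ :=
          enorm_sub_le_lintegral_derivWithin_Icc_of_contDiffOn_Icc
            (contMDiffOn_iff_contDiffOn.1 hs') zero_le_one
      _ ≤ ∫⁻ t in Icc 0 1, C * ‖mfderivWithin 𝓘(ℝ, ℝ) 𝓘(ℝ, F) γ (Icc 0 1) t 1‖ₑ := by
          refine setLIntegral_mono' measurableSet_Icc fun t ht => ?_
          have e : mfderivWithin 𝓘(ℝ, ℝ) 𝓘(ℝ, F) γ' (Icc 0 1) t =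
              (mfderiv 𝓘(ℝ, F) 𝓘(ℝ, F) (extChartAt 𝓘(ℝ, F) a) (γ t)) ∘L
                (mfderivWithin 𝓘(ℝ, ℝ) 𝓘(ℝ, F) γ (Icc 0 1) t) :=
            mfderiv_comp_mfderivWithin t (mdifferentiableAt_extChartAt (hsrc t ht))
              (hγs.mdifferentiableOn one_ne_zero t ht)
              (by rw [uniqueMDiffWithinAt_iff_uniqueDiffWithinAt]
                  exact uniqueDiffOn_Icc zero_lt_one t ht)
          rw [mfderivWithin_eq_fderivWithin] at e
          rw [← fderivWithin_derivWithin, e]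
          exact (hball (hmaps t ht)).2 _
      _ = C * pathELength 𝓘(ℝ, F) γ 0 1 := by
          rw [lintegral_const_mul' _ _ ENNReal.coe_ne_top,
            pathELength_eq_lintegral_mfderivWithin_Icc]
      _ ≤ C * b := by gcongr
  have : (𝓝[>] (edist x y)).NeBot := nhdsGT_neBot_of_exists_gt ⟨_, hxy⟩
  have lim : Tendsto (fun b : ℝ≥0∞ => C * b) (𝓝[>] (edist x y)) (𝓝 (C * edist x y)) :=
    ((ENNReal.continuous_const_mul ENNReal.coe_ne_top).tendsto _).mono_left nhdsWithin_le_nhds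
  refine ge_of_tendsto lim ?_
  filter_upwards [self_mem_nhdsWithin, nhdsWithin_le_nhds (Iio_mem_nhds hxy)] with b hb hb'
  exact main b hb (le_of_lt hb')

end Chart

/-! ### Uniform Taylor estimate and compactness -/

/-- The derivative is locally Lipschitz, so the mean value inequality on the ball of radius `‖h‖`
around `z` gives a quadratic remainder uniformly in `z`. -/
theorem exists_taylor_two {F G : Type*} [NormedAddCommGroup F] [NormedSpace ℝ F]
    [NormedAddCommGroup G] [NormedSpace ℝ G] {g : F → G} {z₀ : F} (hg : ContDiffAt ℝ 2 g z₀) :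
    ∃ C > 0, ∃ ε > 0, ∀ z ∈ Metric.ball z₀ ε, DifferentiableAt ℝ g z ∧ ‖fderiv ℝ g z‖ ≤ C ∧
      ∀ h, ‖h‖ < ε → ‖g (z + h) - g z - fderiv ℝ g z h‖ ≤ C * ‖h‖ ^ 2 := by
  have hg' : ContDiffAt ℝ 1 (fderiv ℝ g) z₀ := hg.fderiv_right (by norm_num)
  obtain ⟨K, t, ht, hK⟩ := hg'.exists_lipschitzOnWith
  have hdiff : ∀ᶠ z in 𝓝 z₀, DifferentiableAt ℝ g z := by
    filter_upwards [hg.eventually (by simp)] with z hz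
    exact hz.differentiableAt two_ne_zero
  have hbd : ∀ᶠ z in 𝓝 z₀, ‖fderiv ℝ g z‖ < ‖fderiv ℝ g z₀‖ + 1 :=
    hg'.continuousAt.norm.eventually_lt_const (lt_add_one _)
  obtain ⟨ε, hε, hball⟩ := Metric.mem_nhds_iff.1 (inter_mem (inter_mem ht hdiff) hbd)
  refine ⟨K + (‖fderiv ℝ g z₀‖ + 1), by positivity, ε / 2, by positivity, fun z hz => ?_⟩
  have hz' : z ∈ Metric.ball z₀ ε := Metric.ball_subset_ball (by linarith) hz
  refine ⟨(hball hz').1.2, (hball hz').2.le.trans (by simp), fun h hh => ?_⟩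
  have hsub : Metric.closedBall z ‖h‖ ⊆ Metric.ball z₀ ε := by
    intro x hx
    rw [Metric.mem_closedBall] at hx
    rw [Metric.mem_ball] at hz ⊢
    linarith [dist_triangle x z z₀]
  have := Convex.norm_image_sub_le_of_norm_hasFDerivWithin_le' (f := g) (C := K * ‖h‖)
    (φ := fderiv ℝ g z)
    (fun x hx => (hball (hsub hx)).1.2.hasFDerivAt.hasFDerivWithinAt)
    (fun x hx => by
      refine (hK.norm_sub_le (hball (hsub hx)).1.1 (hball hz').1.1).trans ?_
      gcongr
      rwa [← dist_eq_norm, ← Metric.mem_closedBall])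
    (convex_closedBall z ‖h‖) (Metric.mem_closedBall_self (norm_nonneg h))
    (show z + h ∈ Metric.closedBall z ‖h‖ by simp)
  rw [add_sub_cancel_left] at this
  refine this.trans ?_
  rw [mul_assoc, ← pow_two]
  gcongr
  linarith [norm_nonneg (fderiv ℝ g z₀)]

theorem IsCompact.exists_uniform_constant {X : Type*} [TopologicalSpace X] {s : Set X}
    (hs : IsCompact s) {P : ℝ → X → Prop} (hmono : ∀ K K' x, K ≤ K' → P K x → P K' x)
    (h : ∀ x ∈ s, ∃ K, ∀ᶠ y in 𝓝 x, P K y) : ∃ K, ∀ y ∈ s, P K y := by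
  refine hs.induction_on (p := fun t => ∃ K, ∀ y ∈ t, P K y) ⟨0, by simp⟩
    (fun s t hst ⟨K, hK⟩ => ⟨K, fun y hy => hK y (hst hy)⟩) ?_ ?_
  · rintro s t ⟨K, hK⟩ ⟨K', hK'⟩
    exact ⟨max K K', fun y hy => hy.elim (fun hy => hmono _ _ _ (le_max_left _ _) (hK y hy))
      fun hy => hmono _ _ _ (le_max_right _ _) (hK' y hy)⟩
  · intro x hx
    obtain ⟨K, hK⟩ := h x hx
    exact ⟨_, nhdsWithin_le_nhds hK, K, fun y hy => hy⟩

/-! ### Parametrizations by tangent spaces -/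

section Chart

open Manifold Metric
open scoped NNReal ENNReal

variable {F : Type*} [NormedAddCommGroup F] [NormedSpace ℝ F]
  {M : Type*} [EMetricSpace M] [ChartedSpace F M] [IsManifold 𝓘(ℝ, F) 1 M]

/-- The inverse of `chartDeriv a y`, for `y` in the domain of the chart centered at `a`. -/
def chartDerivInv (a y : M) : F →L[ℝ] TangentSpace 𝓘(ℝ, F) y :=
  (trivializationAt F (TangentSpace 𝓘(ℝ, F)) a).symmL ℝ y

theorem chartDeriv_chartDerivInv {a y : M} (hy : y ∈ (extChartAt 𝓘(ℝ, F) a).source) (v : F) :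
    chartDeriv a y (chartDerivInv a y v) = v := by
  rw [extChartAt_source] at hy
  rw [chartDeriv, ← TangentBundle.continuousLinearMapAt_trivializationAt hy]
  exact Trivialization.continuousLinearMapAt_symmL _ (by simpa using hy) v

theorem chartDerivInv_chartDeriv {a y : M} (hy : y ∈ (extChartAt 𝓘(ℝ, F) a).source)
    (v : TangentSpace 𝓘(ℝ, F) y) : chartDerivInv a y (chartDeriv a y v) = v := by
  rw [extChartAt_source] at hy
  rw [chartDeriv, ← TangentBundle.continuousLinearMapAt_trivializationAt hy]
  exact Trivialization.symmL_continuousLinearMapAt _ (by simpa using hy) v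

/-- The parametrization of a neighbourhood of `p` by the tangent space at `p` which is affine in the
chart centered at `a`. -/
def chartParam (a p : M) (u : TangentSpace 𝓘(ℝ, F) p) : M :=
  (extChartAt 𝓘(ℝ, F) a).symm (extChartAt 𝓘(ℝ, F) a p + chartDeriv a p u)

/-- The inverse of `chartParam a p`. -/
def chartParamInv (a p x : M) : TangentSpace 𝓘(ℝ, F) p :=
  chartDerivInv a p (extChartAt 𝓘(ℝ, F) a x - extChartAt 𝓘(ℝ, F) a p)

variable [RiemannianBundle (fun x : M => TangentSpace 𝓘(ℝ, F) x)]

/-- On the ball of radius `ρ` around `a`, the chart centered at `a` is controlled by `K`. -/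
structure IsControlledChart (K : ℝ) (ρ : ℝ≥0∞) (r : ℝ) (a : M) : Prop where
  one_le : 1 ≤ K
  source : eball a ρ ⊆ (extChartAt 𝓘(ℝ, F) a).source
  target : ball (extChartAt 𝓘(ℝ, F) a a) r ⊆ (extChartAt 𝓘(ℝ, F) a).target
  mapsTo : ∀ p ∈ eball a ρ, extChartAt 𝓘(ℝ, F) a p ∈ ball (extChartAt 𝓘(ℝ, F) a a) r
  symm_lip : ∀ x ∈ ball (extChartAt 𝓘(ℝ, F) a a) r, ∀ y ∈ ball (extChartAt 𝓘(ℝ, F) a a) r,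
    edist ((extChartAt 𝓘(ℝ, F) a).symm x) ((extChartAt 𝓘(ℝ, F) a).symm y) ≤
      ENNReal.ofReal (K * ‖x - y‖)
  norm_deriv : ∀ p ∈ eball a ρ, ∀ u : TangentSpace 𝓘(ℝ, F) p, ‖chartDeriv a p u‖ ≤ K * ‖u‖
  norm_derivInv : ∀ p ∈ eball a ρ, ∀ z : F, ‖chartDerivInv a p z‖ ≤ K * ‖z‖
  param : ∀ p ∈ eball a ρ, IsLipschitzParam K p (chartParam (F := F) a p) (chartParamInv a p)

variable [IsContinuousRiemannianBundle F (fun x : M => TangentSpace 𝓘(ℝ, F) x)]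

theorem exists_norm_chartDerivInv_le (a : M) :
    ∃ C : ℝ≥0, ∀ᶠ y in 𝓝 a, ∀ v : F, ‖chartDerivInv a y v‖ ≤ C * ‖v‖ := by
  obtain ⟨C, hC0, hC⟩ :=
    eventually_norm_symmL_trivializationAt_lt F (fun x : M => TangentSpace 𝓘(ℝ, F) x) a
  lift C to ℝ≥0 using hC0.le
  refine ⟨C, ?_⟩
  filter_upwards [hC] with y hy v
  exact (ContinuousLinearMap.le_opNorm (𝕜 := ℝ) (𝕜₂ := ℝ) (E := F)
    (F := TangentSpace 𝓘(ℝ, F) y) (chartDerivInv a y) v).trans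
    (mul_le_mul_of_nonneg_right hy.le (norm_nonneg v))

theorem exists_isControlledChart [IsRiemannianManifold 𝓘(ℝ, F) M] (a : M) :
    ∃ K : ℝ, ∃ ρ : ℝ≥0, 0 < ρ ∧ ∃ r : ℝ, IsControlledChart (F := F) K ρ r a := by
  obtain ⟨C₁, r₁, hr₁, htar, hC₁⟩ := exists_edist_extChartAt_symm_le (F := F) a
  obtain ⟨C₂, r₂, hr₂, hsrc, hC₂⟩ := exists_edist_extChartAt_le (F := F) a
  obtain ⟨C₃, hC₃⟩ := exists_norm_mfderiv_extChartAt_le (F := F) a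
  obtain ⟨C₄, hC₄⟩ := exists_norm_chartDerivInv_le (F := F) a
  have hC₅ : ∀ᶠ y in 𝓝 a,
      extChartAt 𝓘(ℝ, F) a y ∈ ball (extChartAt 𝓘(ℝ, F) a a) (r₁ / 2) :=
    (continuousAt_extChartAt a).preimage_mem_nhds (ball_mem_nhds _ (by positivity))
  obtain ⟨ε, hε, hball⟩ := EMetric.mem_nhds_iff.1 (hC₃.and (hC₄.and hC₅))
  obtain ⟨ρ, hρ, hρlt⟩ := ENNReal.lt_iff_exists_nnreal_btwn.1
    (lt_min hε (show (0 : ℝ≥0∞) < ((r₂ / 2 : ℝ≥0) : ℝ≥0∞) by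
      exact_mod_cast (by positivity : 0 < r₂ / 2)))
  have hρ0 : 0 < ρ := by exact_mod_cast hρ
  have hρ2 : ρ ≤ r₂ / 2 := by exact_mod_cast (hρlt.trans_le (min_le_right _ _)).le
  have hgood := fun p (hp : p ∈ eball a (ρ : ℝ≥0∞)) =>
    hball (eball_subset_eball (hρlt.trans_le (min_le_left _ _)).le hp)
  have h22 : eball a (ρ : ℝ≥0∞) ⊆ eball a (r₂ : ℝ≥0∞) := eball_subset_eball
    (by exact_mod_cast hρ2.trans (div_le_self r₂.2 (by norm_num)))
  have hD : ∀ p ∈ eball a (ρ : ℝ≥0∞), ∀ u : TangentSpace 𝓘(ℝ, F) p,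
      ‖chartDeriv a p u‖ ≤ C₃ * ‖u‖ := fun p hp u => by
    have := (hgood p hp).1 u
    rw [enorm_eq_nnnorm, enorm_eq_nnnorm] at this
    exact_mod_cast this
  -- Each summand serves one requirement: products are Lipschitz constants of compositions, `4 * C₃
  -- / r₁` keeps arguments in the chart target, and `ρ⁻¹` ensures `K⁻¹ ≤ ρ`.
  set K : ℝ := 1 + C₁ + C₁ * C₃ + C₃ + C₄ + C₄ * C₂ + 4 * C₃ / r₁ + (ρ : ℝ)⁻¹ with hK
  have hpos : (0 : ℝ) ≤ C₁ ∧ (0 : ℝ) ≤ C₁ * C₃ ∧ (0 : ℝ) ≤ C₃ ∧ (0 : ℝ) ≤ C₄ ∧ (0 : ℝ) ≤ C₄ * C₂ ∧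
    (0 : ℝ) ≤ 4 * C₃ / r₁ ∧ 0 ≤ (ρ : ℝ)⁻¹ := by refine ⟨?_, ?_, ?_, ?_, ?_, ?_, ?_⟩ <;> positivity
  obtain ⟨k1, k2, k3, k4, k5, k6, k7⟩ := hpos
  have hK1 : 1 ≤ K := by linarith
  have hK0 : 0 < K := by linarith
  have hKρ : ENNReal.ofReal K⁻¹ ≤ ρ := by
    rw [← ENNReal.ofReal_coe_nnreal]
    exact ENNReal.ofReal_le_ofReal (inv_le_of_inv_le₀ (by exact_mod_cast hρ0) (by linarith))
  have hsymm : ∀ x ∈ ball (extChartAt 𝓘(ℝ, F) a a) r₁, ∀ y ∈ ball (extChartAt 𝓘(ℝ, F) a a) r₁,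
    edist ((extChartAt 𝓘(ℝ, F) a).symm x) ((extChartAt 𝓘(ℝ, F) a).symm y) ≤
      ENNReal.ofReal (C₁ * ‖x - y‖) := fun x hx y hy => by
    refine (hC₁ x hx y hy).trans_eq ?_
    rw [ENNReal.ofReal_mul C₁.coe_nonneg, ENNReal.ofReal_coe_nnreal, edist_eq_enorm_sub,
      ofReal_norm]
  refine ⟨K, ρ, hρ0, r₁, hK1, h22.trans hsrc, htar, fun p hp =>
    ball_subset_ball (by linarith) (hgood p hp).2.2, fun x hx y hy => (hsymm x hx y hy).trans ?_,
    fun p hp u => (hD p hp u).trans ?_, fun p hp z => ((hgood p hp).2.1 z).trans ?_,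
    fun p hp => ?_⟩
  · gcongr; linarith
  · gcongr; linarith
  · gcongr; linarith
  have hps := hsrc (h22 hp)
  have hin : ∀ u : TangentSpace 𝓘(ℝ, F) p, K * ‖u‖ ≤ 1 →
      extChartAt 𝓘(ℝ, F) a p + chartDeriv a p u ∈ ball (extChartAt 𝓘(ℝ, F) a a) r₁ := by
    intro u hu
    have h1 := (hgood p hp).2.2
    rw [mem_ball] at h1 ⊢
    have h2 : 4 * C₃ / r₁ * ‖u‖ ≤ 1 := (by gcongr; linarith :
      4 * C₃ / r₁ * ‖u‖ ≤ K * ‖u‖).trans hu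
    have h3 : C₃ * ‖u‖ ≤ r₁ / 4 := by
      calc C₃ * ‖u‖ = 4 * C₃ / r₁ * ‖u‖ * (r₁ / 4) := by field_simp
        _ ≤ 1 * (r₁ / 4) := by gcongr
        _ = _ := one_mul _
    have h4 : dist (extChartAt 𝓘(ℝ, F) a p + chartDeriv a p u) (extChartAt 𝓘(ℝ, F) a p) ≤
        C₃ * ‖u‖ := by
      rw [dist_eq_norm, add_sub_cancel_left]; exact hD p hp u
    linarith [dist_triangle (extChartAt 𝓘(ℝ, F) a p + chartDeriv a p u) (extChartAt 𝓘(ℝ, F) a p)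
      (extChartAt 𝓘(ℝ, F) a a)]
  have hnear : ∀ x, edist x p < ENNReal.ofReal K⁻¹ → x ∈ eball a (r₂ : ℝ≥0∞) := by
    intro x hx
    rw [mem_eball] at hp ⊢
    calc edist x a ≤ edist x p + edist p a := edist_triangle _ _ _
      _ < ρ + ρ := ENNReal.add_lt_add (hx.trans_le hKρ) hp
      _ ≤ r₂ := by
        rw [← ENNReal.coe_add, ENNReal.coe_le_coe]
        calc ρ + ρ ≤ r₂ / 2 + r₂ / 2 := add_le_add hρ2 hρ2
          _ = r₂ := add_halves r₂
  refine ⟨?_, fun u v hu hv => ?_, fun x y δ hx hy hδ hxy => ?_, fun x hx => ?_, fun u hu => ?_⟩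
  · rw [chartParam, map_zero, add_zero]
    exact (extChartAt 𝓘(ℝ, F) a).left_inv hps
  · refine (hsymm _ (hin u hu) _ (hin v hv)).trans (ENNReal.ofReal_le_ofReal ?_)
    rw [add_sub_add_left_eq_sub, ← map_sub]
    calc C₁ * ‖chartDeriv a p (u - v)‖ ≤ C₁ * (C₃ * ‖u - v‖) := by gcongr; exact hD p hp _
      _ = C₁ * C₃ * ‖u - v‖ := (mul_assoc _ _ _).symm
      _ ≤ K * ‖u - v‖ := by gcongr; linarith
  · have h1 : ‖extChartAt 𝓘(ℝ, F) a x - extChartAt 𝓘(ℝ, F) a y‖ ≤ C₂ * δ := by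
      have := (hC₂ x (hnear x hx) y (hnear y hy)).trans (mul_le_mul_right hxy _)
      rw [edist_eq_enorm_sub, ← ofReal_norm, ← ENNReal.ofReal_coe_nnreal,
        ← ENNReal.ofReal_mul C₂.coe_nonneg] at this
      exact (ENNReal.ofReal_le_ofReal_iff (by positivity)).1 this
    rw [chartParamInv, chartParamInv, ← map_sub, sub_sub_sub_cancel_right]
    calc _ ≤ C₄ * ‖extChartAt 𝓘(ℝ, F) a x - extChartAt 𝓘(ℝ, F) a y‖ := (hgood p hp).2.1 _
      _ ≤ C₄ * (C₂ * δ) := by gcongr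
      _ = C₄ * C₂ * δ := (mul_assoc _ _ _).symm
      _ ≤ K * δ := by gcongr; linarith
  · rw [chartParam, chartParamInv, chartDeriv_chartDerivInv hps, add_sub_cancel]
    exact (extChartAt 𝓘(ℝ, F) a).left_inv (hsrc (hnear x hx))
  · rw [chartParamInv, chartParam, (extChartAt 𝓘(ℝ, F) a).right_inv (htar (hin u hu)),
      add_sub_cancel_left, chartDerivInv_chartDeriv hps]

end Chart

/-! ### Second-order approximation by the derivative -/

section Chart

open Manifold Metric
open scoped NNReal ENNReal

variable {F : Type*} [NormedAddCommGroup F] [NormedSpace ℝ F]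
  {M : Type*} [EMetricSpace M] [ChartedSpace F M]

section

variable [RiemannianBundle (fun x : M => TangentSpace 𝓘(ℝ, F) x)]

/-- In the charts centered at `a` and `b`, the map `f` is approximated near `p` by its derivative, up
to a quadratic error controlled by `K`. -/
structure IsSecondOrderApprox (f : M → M) (a b : M) (K : ℝ) (p : M) : Prop where
  one_le : 1 ≤ K
  norm_mfderiv_le : ∀ u : TangentSpace 𝓘(ℝ, F) p, ‖mfderiv 𝓘(ℝ, F) 𝓘(ℝ, F) f p u‖ ≤ K * ‖u‖
  edist_le : ∀ u : TangentSpace 𝓘(ℝ, F) p, K * ‖u‖ ≤ 1 →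
    edist (f (chartParam a p u)) (chartParam b (f p) (mfderiv 𝓘(ℝ, F) 𝓘(ℝ, F) f p u)) ≤
      ENNReal.ofReal (K * ‖u‖ ^ 2)

theorem IsSecondOrderApprox.mono {f : M → M} {a b : M} {K K' : ℝ} {p : M}
    (h : IsSecondOrderApprox (F := F) f a b K p) (hK : K ≤ K') :
    IsSecondOrderApprox (F := F) f a b K' p := by
  refine ⟨h.one_le.trans hK, fun u => (h.norm_mfderiv_le u).trans (by gcongr), fun u hu =>
    (h.edist_le u (le_trans (by gcongr) hu)).trans (by gcongr)⟩

end

variable [IsManifold 𝓘(ℝ, F) ∞ M]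

/-- The expression of `f` in the charts centered at `a` and `b`. -/
def inCharts (F : Type*) [NormedAddCommGroup F] [NormedSpace ℝ F] {M : Type*} [TopologicalSpace M]
    [ChartedSpace F M] (f : M → M) (a b : M) : F → F :=
  extChartAt 𝓘(ℝ, F) b ∘ f ∘ (extChartAt 𝓘(ℝ, F) a).symm

theorem contDiffAt_inCharts {f : M → M} (hf : ContMDiff 𝓘(ℝ, F) 𝓘(ℝ, F) 2 f) {a b q : M}
    (hq : q ∈ (extChartAt 𝓘(ℝ, F) a).source) (hfq : f q ∈ (extChartAt 𝓘(ℝ, F) b).source) :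
    ContDiffAt ℝ 2 (inCharts F f a b) (extChartAt 𝓘(ℝ, F) a q) := by
  rw [← contMDiffAt_iff_contDiffAt]
  have h1 : ContMDiffAt 𝓘(ℝ, F) 𝓘(ℝ, F) 2 (extChartAt 𝓘(ℝ, F) a).symm
      (extChartAt 𝓘(ℝ, F) a q) :=
    (contMDiffOn_extChartAt_symm a).contMDiffAt (extChartAt_target_mem_nhds' (by
      exact (extChartAt 𝓘(ℝ, F) a).map_source hq))
  have h2 : ContMDiffAt 𝓘(ℝ, F) 𝓘(ℝ, F) 2 (extChartAt 𝓘(ℝ, F) b) (f q) :=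
    contMDiffAt_extChartAt' (by rwa [extChartAt_source] at hfq)
  have e := (extChartAt 𝓘(ℝ, F) a).left_inv hq
  refine ContMDiffAt.comp _ ?_ (hf.contMDiffAt.comp _ h1)
  rwa [Function.comp_apply, e]

theorem chartDeriv_mfderiv {f : M → M} (hf : ContMDiff 𝓘(ℝ, F) 𝓘(ℝ, F) 2 f) {a b p : M}
    (hp : p ∈ (extChartAt 𝓘(ℝ, F) a).source) (hfp : f p ∈ (extChartAt 𝓘(ℝ, F) b).source)
    (u : TangentSpace 𝓘(ℝ, F) p) :
    chartDeriv b (f p) (mfderiv 𝓘(ℝ, F) 𝓘(ℝ, F) f p u) =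
      fderiv ℝ (inCharts F f a b) (extChartAt 𝓘(ℝ, F) a p) (chartDeriv a p u) := by
  have h1 : extChartAt 𝓘(ℝ, F) b ∘ f =ᶠ[𝓝 p] inCharts F f a b ∘ extChartAt 𝓘(ℝ, F) a := by
    filter_upwards [extChartAt_source_mem_nhds' hp] with x hx
    simp only [inCharts, Function.comp_apply, (extChartAt 𝓘(ℝ, F) a).left_inv hx]
  have h2 : mfderiv 𝓘(ℝ, F) 𝓘(ℝ, F) (extChartAt 𝓘(ℝ, F) b ∘ f) p =
      (mfderiv 𝓘(ℝ, F) 𝓘(ℝ, F) (extChartAt 𝓘(ℝ, F) b) (f p)) ∘L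
        (mfderiv 𝓘(ℝ, F) 𝓘(ℝ, F) f p) :=
    mfderiv_comp p (mdifferentiableAt_extChartAt (by rwa [extChartAt_source] at hfp))
      (hf.mdifferentiableAt two_ne_zero)
  have h3 : mfderiv 𝓘(ℝ, F) 𝓘(ℝ, F) (inCharts F f a b ∘ extChartAt 𝓘(ℝ, F) a) p =
      (mfderiv 𝓘(ℝ, F) 𝓘(ℝ, F) (inCharts F f a b) (extChartAt 𝓘(ℝ, F) a p)) ∘L
        (mfderiv 𝓘(ℝ, F) 𝓘(ℝ, F) (extChartAt 𝓘(ℝ, F) a) p) :=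
    mfderiv_comp p ((contDiffAt_inCharts hf hp hfp).differentiableAt two_ne_zero).mdifferentiableAt
      (mdifferentiableAt_extChartAt (by rwa [extChartAt_source] at hp))
  rw [← mfderiv_eq_fderiv]
  have h4 := h2.symm.trans (h1.mfderiv_eq.trans h3)
  exact congr($h4 u)

variable [RiemannianBundle (fun x : M => TangentSpace 𝓘(ℝ, F) x)]

/-- The parametrizations are affine in the charts, so in the chart at `b` the two points are `g (z +
h)` and `g z + fderiv ℝ g z h`. They differ by the Taylor remainder, and the inverse chart is
Lipschitz. -/
theorem exists_isSecondOrderApprox {f : M → M} (hf : ContMDiff 𝓘(ℝ, F) 𝓘(ℝ, F) 2 f)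
    {a b q : M} {Ka Kb ra rb : ℝ} {ρa ρb : ℝ≥0∞} (ha : IsControlledChart (F := F) Ka ρa ra a)
    (hb : IsControlledChart (F := F) Kb ρb rb b) (hq : q ∈ eball a ρa) (hfq : f q ∈ eball b ρb) :
    ∃ K, ∀ᶠ p in 𝓝 q, IsSecondOrderApprox (F := F) f a b K p := by
  set g := inCharts F f a b with hg
  set z₀ := extChartAt 𝓘(ℝ, F) a q with hz₀
  have hKa := ha.one_le
  have hKb := hb.one_le
  have hgC : ContDiffAt ℝ 2 g z₀ := contDiffAt_inCharts hf (ha.source hq) (hb.source hfq)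
  obtain ⟨C, hC, ε, hε, hT⟩ := exists_taylor_two hgC
  have hsq : (extChartAt 𝓘(ℝ, F) a).symm z₀ = q := (extChartAt 𝓘(ℝ, F) a).left_inv (ha.source hq)
  have hgz₀ : g z₀ = extChartAt 𝓘(ℝ, F) b (f q) := by
    simp only [hg, inCharts, Function.comp_apply, hsq]
  obtain ⟨σ, hσ, hσb⟩ : ∃ σ > 0, ball (g z₀) σ ⊆ ball (extChartAt 𝓘(ℝ, F) b b) rb :=
    Metric.isOpen_iff.1 isOpen_ball _ (hgz₀ ▸ hb.mapsTo _ hfq)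
  have hcont : ContinuousAt (f ∘ (extChartAt 𝓘(ℝ, F) a).symm) z₀ :=
    hf.continuous.continuousAt.comp (continuousAt_extChartAt_symm' (ha.source hq))
  have hev1 : ∀ᶠ z in 𝓝 z₀, f ((extChartAt 𝓘(ℝ, F) a).symm z) ∈ eball b ρb :=
    hcont.preimage_mem_nhds (isOpen_eball.mem_nhds (by rwa [Function.comp_apply, hsq]))
  have hev2 : ∀ᶠ z in 𝓝 z₀, g z ∈ ball (g z₀) (σ / 2) :=
    hgC.continuousAt.preimage_mem_nhds (ball_mem_nhds _ (by positivity))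
  obtain ⟨τ, hτ, hball⟩ := Metric.mem_nhds_iff.1 (hev1.and hev2)
  -- The three bounds keep `z + h` where `f` lands in the chart at `b`, permit the Taylor estimate,
  -- and keep the linearized value in the target ball.
  set κ := min (min (τ / 2) ε) (σ / (2 * C)) with hκ
  have hκ0 : 0 < κ := by positivity
  have hκτ : κ ≤ τ / 2 := (min_le_left _ _).trans (min_le_left _ _)
  have hκε : κ ≤ ε := (min_le_left _ _).trans (min_le_right _ _)
  have hκσ : κ ≤ σ / (2 * C) := min_le_right _ _
  refine ⟨Ka + Kb * C * Ka + 2 * Ka / κ + Kb * C * Ka ^ 2, ?_⟩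
  set K := Ka + Kb * C * Ka + 2 * Ka / κ + Kb * C * Ka ^ 2 with hK
  have k1 : 0 ≤ Kb * C * Ka := by positivity
  have k2 : 0 ≤ 2 * Ka / κ := by positivity
  have k3 : 0 ≤ Kb * C * Ka ^ 2 := by positivity
  have hev3 : ∀ᶠ p in 𝓝 q, extChartAt 𝓘(ℝ, F) a p ∈ ball z₀ κ :=
    (continuousAt_extChartAt' (ha.source hq)).preimage_mem_nhds (ball_mem_nhds _ hκ0)
  filter_upwards [hev3, isOpen_eball.mem_nhds hq,
    hf.continuous.continuousAt.preimage_mem_nhds (isOpen_eball.mem_nhds hfq)] with p hpz hpa hfp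
  set z := extChartAt 𝓘(ℝ, F) a p with hz
  have hps := ha.source hpa
  have hfps := hb.source hfp
  obtain ⟨hgd, hgC', htay⟩ := hT z (ball_subset_ball hκε hpz)
  have hderiv : ∀ u : TangentSpace 𝓘(ℝ, F) p,
      chartDeriv b (f p) (mfderiv 𝓘(ℝ, F) 𝓘(ℝ, F) f p u) = fderiv ℝ g z (chartDeriv a p u) :=
    chartDeriv_mfderiv hf hps hfps
  have hgh : ∀ h : F, ‖fderiv ℝ g z h‖ ≤ C * ‖h‖ := fun h =>
    ((fderiv ℝ g z).le_opNorm h).trans (by gcongr)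
  refine ⟨by linarith, fun u => ?_, fun u hu => ?_⟩
  · rw [← chartDerivInv_chartDeriv (a := b) hfps (mfderiv 𝓘(ℝ, F) 𝓘(ℝ, F) f p u), hderiv]
    calc _ ≤ Kb * ‖fderiv ℝ g z (chartDeriv a p u)‖ := hb.norm_derivInv _ hfp _
      _ ≤ Kb * (C * (Ka * ‖u‖)) := by
        gcongr
        exact (hgh _).trans (by gcongr; exact ha.norm_deriv _ hpa u)
      _ = Kb * C * Ka * ‖u‖ := by ring
      _ ≤ K * ‖u‖ := by gcongr; linarith
  · set h := chartDeriv a p u with hh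
    have hKu : 2 * Ka / κ * ‖u‖ ≤ 1 := (by gcongr; linarith :
      2 * Ka / κ * ‖u‖ ≤ K * ‖u‖).trans hu
    have hhu : ‖h‖ ≤ Ka * ‖u‖ := ha.norm_deriv _ hpa u
    have hhκ : ‖h‖ < κ := by
      refine hhu.trans_lt ?_
      calc Ka * ‖u‖ = 2 * Ka / κ * ‖u‖ * (κ / 2) := by field_simp
        _ ≤ 1 * (κ / 2) := by gcongr
        _ < κ := by linarith
    have hzτ : z ∈ ball z₀ τ := ball_subset_ball (by linarith) hpz
    have hzhτ : z + h ∈ ball z₀ τ := by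
      rw [mem_ball] at hpz ⊢
      have : dist (z + h) z = ‖h‖ := by rw [dist_eq_norm, add_sub_cancel_left]
      linarith [dist_triangle (z + h) z z₀]
    have hleft : f (chartParam a p u) = (extChartAt 𝓘(ℝ, F) b).symm (g (z + h)) :=
      ((extChartAt 𝓘(ℝ, F) b).left_inv (hb.source (hball hzhτ).1)).symm
    have hright : chartParam b (f p) (mfderiv 𝓘(ℝ, F) 𝓘(ℝ, F) f p u) =
        (extChartAt 𝓘(ℝ, F) b).symm (g z + fderiv ℝ g z h) := by
      have hgz : g z = extChartAt 𝓘(ℝ, F) b (f p) := by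
        simp only [hg, inCharts, Function.comp_apply, hz, (extChartAt 𝓘(ℝ, F) a).left_inv hps]
      rw [chartParam, hderiv, ← hgz]
    have hin1 : g (z + h) ∈ ball (extChartAt 𝓘(ℝ, F) b b) rb :=
      hσb (ball_subset_ball (by linarith) (hball hzhτ).2)
    have hin2 : g z + fderiv ℝ g z h ∈ ball (extChartAt 𝓘(ℝ, F) b b) rb := by
      apply hσb
      have h1 : dist (g z) (g z₀) < σ / 2 := (hball hzτ).2
      have h2 : dist (g z + fderiv ℝ g z h) (g z) ≤ C * ‖h‖ := by
        rw [dist_eq_norm, add_sub_cancel_left]; exact hgh h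
      have h3 : C * ‖h‖ ≤ σ / 2 := by
        calc C * ‖h‖ ≤ C * (σ / (2 * C)) := by gcongr; exact hhκ.le.trans hκσ
          _ = σ / 2 := by field_simp
      rw [mem_ball]
      linarith [dist_triangle (g z + fderiv ℝ g z h) (g z) (g z₀)]
    rw [hleft, hright]
    refine (hb.symm_lip _ hin1 _ hin2).trans (ENNReal.ofReal_le_ofReal ?_)
    rw [← sub_sub]
    calc Kb * ‖g (z + h) - g z - fderiv ℝ g z h‖ ≤ Kb * (C * (Ka * ‖u‖) ^ 2) := by
          gcongr
          exact (htay h (hhκ.trans_le hκε)).trans (by gcongr)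
      _ = Kb * C * Ka ^ 2 * ‖u‖ ^ 2 := by ring
      _ ≤ K * ‖u‖ ^ 2 := by gcongr; linarith

variable [IsContinuousRiemannianBundle F (fun x : M => TangentSpace 𝓘(ℝ, F) x)]

/-- On a compact Riemannian manifold, every point has a chart in which parametrizations and
second-order approximations of a `C^2` map are controlled by a uniform constant. -/
theorem exists_uniform_charts [CompactSpace M] [IsRiemannianManifold 𝓘(ℝ, F) M] {f : M → M}
    (hf : ContMDiff 𝓘(ℝ, F) 𝓘(ℝ, F) 2 f) :
    ∃ (c : M → M) (K : ℝ), 1 ≤ K ∧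
      (∀ p, IsLipschitzParam K p (chartParam (F := F) (c p) p) (chartParamInv (c p) p)) ∧
      ∀ p, IsSecondOrderApprox (F := F) f (c p) (c (f p)) K p := by
  choose Kc ρ hρ r hc using exists_isControlledChart (F := F) (M := M)
  have hhalf : ∀ a : M, ((ρ a / 2 : ℝ≥0) : ℝ≥0∞) < ρ a := fun a => by
    exact_mod_cast NNReal.half_lt_self (hρ a).ne'
  obtain ⟨T, -, hT⟩ := isCompact_univ.elim_nhds_subcover
    (fun a : M => eball a ((ρ a / 2 : ℝ≥0) : ℝ≥0∞))
    fun a _ => eball_mem_nhds a (by exact_mod_cast half_pos (hρ a))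
  have hcov : ∀ p : M, ∃ a ∈ T, p ∈ eball a ((ρ a / 2 : ℝ≥0) : ℝ≥0∞) := fun p => by
    simpa using hT (mem_univ p)
  choose c hcT hcp using hcov
  -- Closed sets inside the full balls are compact, so each of the finitely many pairs of charts has
  -- one constant; `c` needs no continuity.
  set D : M → Set M := fun a => {x | edist x a ≤ ((ρ a / 2 : ℝ≥0) : ℝ≥0∞)} with hD
  have hDclosed : ∀ a, IsClosed (D a) := fun a =>
    isClosed_le (continuous_id.edist continuous_const) continuous_const
  have hcD : ∀ p, p ∈ D (c p) := fun p => (mem_eball.1 (hcp p)).le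
  have hDρ : ∀ a, D a ⊆ eball a (ρ a) := fun a x hx =>
    mem_eball.2 (lt_of_le_of_lt hx (hhalf a))
  have hpair : ∀ a b : M, ∃ K, ∀ p ∈ D a ∩ f ⁻¹' D b,
      IsSecondOrderApprox (F := F) f a b K p := fun a b =>
    IsCompact.exists_uniform_constant
      ((hDclosed a).inter ((hDclosed b).preimage hf.continuous)).isCompact
      (fun K K' x hKK' hx => hx.mono hKK')
      fun q hq => exists_isSecondOrderApprox hf (hc a) (hc b) (hDρ a hq.1) (hDρ b hq.2)
  choose Kp hKp using hpair
  obtain ⟨K₁, hK₁⟩ := (T.image Kc).exists_le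
  obtain ⟨K₂, hK₂⟩ := ((T ×ˢ T).image fun ab => Kp ab.1 ab.2).exists_le
  refine ⟨c, max 1 (max K₁ K₂), le_max_left _ _, fun p => ?_, fun p => ?_⟩
  · exact ((hc (c p)).param p (hDρ _ (hcD p))).mono (zero_lt_one.trans_le (hc (c p)).one_le)
      (le_max_of_le_right (le_max_of_le_left
        (hK₁ _ (Finset.mem_image_of_mem Kc (hcT p)))))
  · exact (hKp (c p) (c (f p)) p ⟨hcD p, hcD (f p)⟩).mono
      (le_max_of_le_right (le_max_of_le_right
        (hK₂ _ (Finset.mem_image.2 ⟨(c p, c (f p)), Finset.mk_mem_product (hcT p) (hcT (f p)),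
          rfl⟩))))

end Chart

/-! ### The derivative cocycle -/

section Derivative

variable {m : ℕ} {M : Type*} [EMetricSpace M] [ChartedSpace (EuclideanSpace ℝ (Fin m)) M]

theorem chartParam_tangentCongr {x y : M} (h : x = y) (a : M) (v : TangentSpace (𝓡 m) x) :
    chartParam (F := EuclideanSpace ℝ (Fin m)) a y (tangentCongr m h v) = chartParam a x v := by
  subst h
  rfl

theorem derivCocycle_apply [IsManifold (𝓡 m) ∞ M] (f : M ≃ₘ^2⟮𝓡 m, 𝓡 m⟯ M) {p : ℤ → M}
    (hp : IsTrajectory f univ p) (k : ℤ) (v : TangentSpace (𝓡 m) (p k)) :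
    derivCocycle f p hp k v = tangentCongr m (hp k (mem_univ _) (mem_univ _)).symm
      (mfderiv (𝓡 m) (𝓡 m) f (p k) v) :=
  rfl

variable [RiemannianBundle (fun x : M => TangentSpace (𝓡 m) x)]

theorem norm_tangentCongr {x y : M} (h : x = y) (v : TangentSpace (𝓡 m) x) :
    ‖tangentCongr m h v‖ = ‖v‖ := by
  subst h
  rfl

/-- The hypothesis is an equation so that substitution also identifies the tangent space at `g x`
with that at `x`. -/
theorem norm_mfderiv_of_eq_id {g : M → M} (hg : g = id) {x : M} (v : TangentSpace (𝓡 m) x) :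
    ‖mfderiv (𝓡 m) (𝓡 m) g x v‖ = ‖v‖ := by
  subst hg
  rw [mfderiv_id]
  rfl

theorem norm_le_norm_mfderiv (f : M ≃ₘ^2⟮𝓡 m, 𝓡 m⟯ M) {K : ℝ}
    (hK : ∀ (x : M) (u : TangentSpace (𝓡 m) x), ‖mfderiv (𝓡 m) (𝓡 m) f.symm x u‖ ≤ K * ‖u‖)
    (x : M) (v : TangentSpace (𝓡 m) x) : ‖v‖ ≤ K * ‖mfderiv (𝓡 m) (𝓡 m) f x v‖ := by
  have h1 : mfderiv (𝓡 m) (𝓡 m) (f.symm ∘ f) x =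
      (mfderiv (𝓡 m) (𝓡 m) f.symm (f x)) ∘L (mfderiv (𝓡 m) (𝓡 m) f x) :=
    mfderiv_comp x (f.symm.contMDiff.mdifferentiableAt two_ne_zero)
      (f.contMDiff.mdifferentiableAt two_ne_zero)
  have h2 := norm_mfderiv_of_eq_id (m := m) (g := f.symm ∘ f) (by ext; simp) v
  rw [← h2, h1]
  exact hK _ _

variable [IsManifold (𝓡 m) ∞ M]

theorem norm_derivCocycle_apply (f : M ≃ₘ^2⟮𝓡 m, 𝓡 m⟯ M) {p : ℤ → M}
    (hp : IsTrajectory f univ p) (k : ℤ) (v : TangentSpace (𝓡 m) (p k)) :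
    ‖derivCocycle f p hp k v‖ = ‖mfderiv (𝓡 m) (𝓡 m) f (p k) v‖ := by
  rw [derivCocycle_apply, norm_tangentCongr]

theorem uniformlyBounded_derivCocycle (f : M ≃ₘ^2⟮𝓡 m, 𝓡 m⟯ M) {K K' : ℝ} (hK0 : 0 ≤ K)
    (hK0' : 0 ≤ K')
    (hK : ∀ (x : M) (u : TangentSpace (𝓡 m) x), ‖mfderiv (𝓡 m) (𝓡 m) f x u‖ ≤ K * ‖u‖)
    (hK' : ∀ (x : M) (u : TangentSpace (𝓡 m) x), ‖mfderiv (𝓡 m) (𝓡 m) f.symm x u‖ ≤ K' * ‖u‖)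
    {p : ℤ → M} (hp : IsTrajectory f univ p) : UniformlyBounded (derivCocycle f p hp) := by
  refine ⟨max K K' + 1, by positivity, fun k => ⟨?_, ?_⟩⟩
  · refine lt_of_le_of_lt (ContinuousLinearMap.opNorm_le_bound _ hK0 fun v => ?_)
      ((le_max_left K K').trans_lt (lt_add_one _))
    exact (norm_derivCocycle_apply f hp k v).trans_le (hK _ v)
  · refine lt_of_le_of_lt (ContinuousLinearMap.opNorm_le_bound _ hK0' fun w => ?_)
      ((le_max_right K K').trans_lt (lt_add_one _))
    have h := norm_le_norm_mfderiv f hK' (p k) ((derivCocycle f p hp k).symm w)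
    rw [← norm_derivCocycle_apply f hp, ContinuousLinearEquiv.apply_symm_apply] at h
    exact h

end Derivative

end FinHolder

end

theorem lemma2 {m : ℕ} {M : Type*} [EMetricSpace M] [CompactSpace M]
    [ChartedSpace (EuclideanSpace ℝ (Fin m)) M] [IsManifold (𝓡 m) ∞ M]
    [RiemannianBundle (fun x : M => TangentSpace (𝓡 m) x)]
    [IsContMDiffRiemannianBundle (𝓡 m) ∞ (EuclideanSpace ℝ (Fin m))
      (fun x : M => TangentSpace (𝓡 m) x)]
    [IsRiemannianManifold (𝓡 m) M]
    (f : M ≃ₘ^2⟮𝓡 m, 𝓡 m⟯ M) (θ η : ℝ) (hθ : θ ∈ Ioo (0 : ℝ) 1) (hη : 0 ≤ η)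
    (hf : FinHolder.FinHolSh f θ η) (hθ' : 1 / 2 < θ) (hθη : 1 < θ + η) :
    ∃ γ ∈ Ioo (0 : ℝ) 1, ∀ (p : ℤ → M) (hp : FinHolder.IsTrajectory f univ p),
      FinHolder.UniformlyBounded (FinHolder.derivCocycle f p hp) ∧
        FinHolder.SlowGrowth (FinHolder.derivCocycle f p hp) γ := by
  have : IsContinuousRiemannianBundle (EuclideanSpace ℝ (Fin m))
      (fun x : M => TangentSpace (𝓡 m) x) :=
    ⟨(IsContMDiffRiemannianBundle.exists_contMDiff (IB := 𝓡 m) (n := ∞)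
      (F := EuclideanSpace ℝ (Fin m)) (E := fun x : M => TangentSpace (𝓡 m) x)).imp
        fun g hg => ⟨hg.1.continuous, hg.2⟩⟩
  have hη0 : 0 < η := by linarith [hθ.2]
  obtain ⟨c, K, hK, hparam, happrox⟩ := FinHolder.exists_uniform_charts f.contMDiff
  -- For the inverse map only the derivative bound is needed, to bound the inverses of the cocycle.
  obtain ⟨_, K', hK', -, happrox'⟩ := FinHolder.exists_uniform_charts f.symm.contMDiff
  obtain ⟨B, hB, hsol⟩ := hf.exists_slowGrowth_bound hθ.2 hθ' hη0 hK
  refine ⟨(1 - θ) / η, ⟨div_pos (by linarith [hθ.2]) hη0,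
    (div_lt_one hη0).2 (by linarith)⟩, fun p hp => ⟨?_, B, hB, ?_⟩⟩
  · exact FinHolder.uniformlyBounded_derivCocycle f (by linarith) (by linarith)
      (fun x => (happrox x).norm_mfderiv_le) (fun x => (happrox' x).norm_mfderiv_le) hp
  · refine hsol (fun k => TangentSpace (𝓡 m) (p k)) (FinHolder.derivCocycle f p hp) p
      (fun k => FinHolder.chartParam (c (p k)) (p k))
      (fun k => FinHolder.chartParamInv (c (p k)) (p k)) (fun k => hparam (p k))
      (fun k u => (FinHolder.norm_derivCocycle_apply f hp k u).trans_le
        ((happrox (p k)).norm_mfderiv_le u)) fun k u hu => ?_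
    rw [FinHolder.derivCocycle_apply, FinHolder.chartParam_tangentCongr]
    have h := (happrox (p k)).edist_le u hu
    rwa [← hp k (mem_univ _) (mem_univ _)] at h ⊢
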